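/- **Setting.** Let $\Omega\subset\mathbb R^d$ be a bounded domain, $B_\epsilon$ a set of perforations, $\Omega^\epsilon=\Omega\setminus\overline{B_\epsilon}$, $\mathbf V_0=H^1_0(\Omega^\epsilon)^d$ (the closure of $C_c^\infty(\Omega^\epsilon)^d$ in $H^1$), $Q_0=L^2_0(\Omega^\epsilon)$ (zero mean), and $$a(\mathbf u,\mathbf v)=\int_{\Omega^\epsilon}\nabla\mathbf u:\nabla\mathbf v\,dx,\qquad b(\mathbf v,q)=\int_{\Omega^\epsilon}q\,\nabla\cdot\mathbf v\,dx,\qquad \|\mathbf v\|_a=a(\mathbf v,\mathbf v)^{1/2}.$$ Let $\|\cdot\|$ and $\langle\cdot,\cdot\rangle$ be the norm and inner product of $L^2(\Omega^\epsilon)^d$. *Coarse grid.* $K_1,\dots,K_N\subset\overline{\Omega^\epsilon}$ are closed sets that cover $\Omega^\epsilon$, whose interiors are nonempty, pairwise disjoint, contained in $\Omega^\epsilon$ and satisfy the interior cone condition (no cusps), and whose boundaries are null sets; $H=\max_i\operatorname{diam}K_i$. *Weight.* $\chi_1,\dots,\chi_{N_c}$ are locally Lipschitz functions with bounded gradients,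 $0\le\chi_j\le1$ and $\sum_j\chi_j=1$ on $\Omega^\epsilon$, such that $\tilde\kappa=\sum_j|\nabla\chi_j|^2>0$ almost everywhere. *Auxiliary space.* Let $\mathbf V(K_i)$ be the $H^1(K_i)$-closure of the restrictions to $K_i$ of elements of $\mathbf V_0$, $a_i(\mathbf u,\mathbf v)=\int_{K_i}\nabla\mathbf u:\nabla\mathbf v\,dx$ and $s_i(\mathbf u,\mathbf v)=\int_{K_i}\tilde\kappa\,\mathbf u\cdot\mathbf v\,dx$. Let $(\phi^i_j,\lambda^i_j)_{j\ge1}$ be the eigenpairs of $$a_i(\phi,\mathbf v)=\lambda\, s_i(\phi,\mathbf v)\quad\text{for all }\mathbf v\in\mathbf V(K_i),\qquad \phi\in\mathbf V(K_i),$$ listed with multiplicity, $\lambda^i_1\le\lambda^i_2\le\cdots$, with $s_i$-orthonormal eigenfunctions. Choose numbers $\ell_i$ and put $V_{\rm aux}=\bigoplus_i\operatorname{span}\{\phi^i_1,\dots,\phi^i_{\ell_i}\}$ with the inner product $s=\sum_i s_i$, $\ \pi(\mathbf v)=\sum_i\sum_{j\le\ell_i}s_i(\mathbf v,\phi^i_j)\phi^i_j$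 and $\Lambda=\min_i\lambda^i_{\ell_i+1}$. Assume $\Lambda>0$. *Global multiscale space.* Let $\psi^i_j$ be the minimizer of $a(\psi,\psi)+s(\pi\psi-\phi^i_j,\pi\psi-\phi^i_j)$ over the divergence-free $\psi\in\mathbf V_0$, and $V_{\rm glo}=\operatorname{span}\{\psi^i_j:1\le i\le N,\ 1\le j\le\ell_i\}$. *Solutions.* For $\mathbf f\in L^2(\Omega^\epsilon)^d$ let $(\mathbf u,p)\in\mathbf V_0\times Q_0$ solve the Stokes problem $$a(\mathbf u,\mathbf v)-b(\mathbf v,p)=\langle\mathbf f,\mathbf v\rangle\ \ (\mathbf v\in\mathbf V_0),\qquad b(\mathbf u,q)=0\ \ (q\in Q_0),$$ and let $\mathbf u_{\rm glo}\in V_{\rm glo}$ solve $a(\mathbf u_{\rm glo},\mathbf v)=\langle\mathbf f,\mathbf v\rangle$ for all $\mathbf v\in V_{\rm glo}$. **Theorem.** There is an absolute constant $C$ with $$\|\mathbf u-\mathbf u_{\rm glo}\|_a\le C\,\Lambda^{-1/2}\,\|\tilde\kappa^{-1/2}\mathbf f\|$$ (the right-hand side may be $+\infty$). Moreover, suppose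 that the partition of unity is bilinear (multilinear in $\mathbb R^d$): each $K_i$ is contained in a cell which is the one-to-one image of $[0,1]^d$ under a multilinear map, whose corners are nodes $x_j$ of the grid and whose set of corners has diameter at most $\rho H$ (with $\rho=1$ if the corners belong to $K_i$), and on $K_i\cap\Omega^\epsilon$ the function $\chi_j$ is the multilinear shape function of the corner $x_j$ of the cell, or $0$ if $x_j$ is not a corner of the cell. Then $$\|\mathbf u-\mathbf u_{\rm glo}\|_a\le C\,H\,\Lambda^{-1/2}\,\|\mathbf f\|$$ with $C$ depending only on $d$ and $\rho$. In particular, for every $\Lambda_0$ there is a constant $C$ depending only on $d$, $\rho$ and $\Lambda_0$ such that $\|\mathbf u-\mathbf u_{\rm glo}\|_a\le C\,H\,\Lambda^{-1}\,\|\mathbf f\|$ whenever $\Lambda\le\Lambda_0$. -/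

import Mathlib

open MeasureTheory Set
open scoped ContDiff

noncomputable section

namespace StokesCEM

/-- Points of `ℝ^d`, and values of velocity fields. -/
abbrev Vec (d : ℕ) : Type := EuclideanSpace ℝ (Fin d)

/-- `d × d` matrices with the Frobenius inner product `A : B = ∑ A (i, j) * B (i, j)`. -/
abbrev Mat (d : ℕ) : Type := EuclideanSpace ℝ (Fin d × Fin d)

/-- The ambient Hilbert space `L²(μ; ℝ^d) × L²(μ; ℝ^{d × d})` of pairs (field, weak gradient).
Its norm is the `H¹` norm `(‖v‖² + ‖∇v‖²)^{1/2}`. -/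
abbrev SobPair (d : ℕ) (μ : Measure (Vec d)) : Type :=
  WithLp 2 (Lp (Vec d) 2 μ × Lp (Mat d) 2 μ)

/-- The Jacobian matrix of a vector field; its `(i, j)` entry is `∂_j v_i`. -/
def jacobian {d : ℕ} (v : Vec d → Vec d) (x : Vec d) : Mat d :=
  WithLp.toLp 2 fun ij : Fin d × Fin d =>
    (fderiv ℝ v x (EuclideanSpace.single ij.2 (1 : ℝ))) ij.1

/-- Test fields: elements of `C_c^∞(D)^d`. -/
def IsTestField {d : ℕ} (D : Set (Vec d)) (v : Vec d → Vec d) : Prop :=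
  ContDiff ℝ ∞ v ∧ HasCompactSupport v ∧ tsupport v ⊆ D

/-- `H¹₀(D)^d`: the closure of `C_c^∞(D)^d` in the `H¹` norm, a field being recorded together
with its (weak) gradient. The set of pairs whose span is taken is already a linear subspace. -/
def V0 {d : ℕ} (D : Set (Vec d)) : Submodule ℝ (SobPair d (volume.restrict D)) :=
  (Submodule.span ℝ {U : SobPair d (volume.restrict D) | ∃ v : Vec d → Vec d, IsTestField D v ∧
    (U.fst : Vec d → Vec d) =ᵐ[volume.restrict D] v ∧
    (U.snd : Vec d → Mat d) =ᵐ[volume.restrict D] jacobian v}).topologicalClosure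

/-- Restriction of a field and of its gradient to a subset `K`. -/
def restr {d : ℕ} (μ : Measure (Vec d)) (K : Set (Vec d)) :
    SobPair d μ →ₗ[ℝ] SobPair d (μ.restrict K) :=
  (WithLp.linearEquiv 2 ℝ (Lp (Vec d) 2 (μ.restrict K) × Lp (Mat d) 2 (μ.restrict K))).symm ∘ₗ
    ((LpToLpRestrictCLM (Vec d) (Vec d) ℝ μ 2 K).toLinearMap.prodMap
      (LpToLpRestrictCLM (Vec d) (Mat d) ℝ μ 2 K).toLinearMap ∘ₗ
    (WithLp.linearEquiv 2 ℝ (Lp (Vec d) 2 μ × Lp (Mat d) 2 μ)).toLinearMap)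

/-- `V(K)`: the closure in `H¹(K)^d` of the space of restrictions to `K` of the elements of
`H¹₀(D)^d`. -/
def VLoc {d : ℕ} (D K : Set (Vec d)) :
    Submodule ℝ (SobPair d ((volume.restrict D).restrict K)) :=
  ((V0 D).map (restr (volume.restrict D) K)).topologicalClosure

/-- `a(u, v) = ∫ ∇u : ∇v`, over the set on which the pairs live. -/
def aForm {d : ℕ} {μ : Measure (Vec d)} (U V : SobPair d μ) : ℝ :=
  ∫ x, inner ℝ (U.snd x) (V.snd x) ∂μ

/-- `∫ κ u · v`, over the set on which the pairs live. -/
def sForm {d : ℕ} {μ : Measure (Vec d)} (κ : Vec d → ℝ) (U V : SobPair d μ) : ℝ :=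
  ∫ x, κ x * inner ℝ (U.fst x) (V.fst x) ∂μ

/-- The divergence: the trace of the weak gradient. -/
def div {d : ℕ} {μ : Measure (Vec d)} (U : SobPair d μ) (x : Vec d) : ℝ :=
  ∑ i : Fin d, U.snd x (i, i)

/-- `b(v, q) = ∫ q ∇·v`. -/
def bForm {d : ℕ} {μ : Measure (Vec d)} (U : SobPair d μ) (q : Lp ℝ 2 μ) : ℝ :=
  ∫ x, q x * div U x ∂μ

/-- The energy norm `‖v‖_a = a(v, v)^{1/2}`. -/
def energyNorm {d : ℕ} {μ : Measure (Vec d)} (U : SobPair d μ) : ℝ := √(aForm U U)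

/-- Divergence-free elements of `H¹₀(D)^d`. -/
def V0div {d : ℕ} (D : Set (Vec d)) : Set (SobPair d (volume.restrict D)) :=
  {U | U ∈ V0 D ∧ ∀ᵐ x ∂(volume.restrict D), div U x = 0}

/-- The interior cone condition: every point of `G` is the vertex of a spherical cone contained
in `G`, all these cones having the same opening and the same height. -/
def ConeCondition {d : ℕ} (G : Set (Vec d)) : Prop :=
  ∃ c h : ℝ, 0 < c ∧ c < 1 ∧ 0 < h ∧ ∀ x ∈ G, ∃ ξ : Vec d, ‖ξ‖ = 1 ∧
    ∀ y : Vec d, ‖y - x‖ < h → c * ‖y - x‖ ≤ inner ℝ ξ (y - x) → y ∈ G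

/-- A partition of `D` into coarse blocks: closed sets with nonempty interior whose boundary is
a null set without cusps, which cover `D` and do not overlap. -/
structure IsCoarseGrid {d N : ℕ} (D : Set (Vec d)) (K : Fin N → Set (Vec d)) : Prop where
  isClosed : ∀ i, IsClosed (K i)
  subset_closure : ∀ i, K i ⊆ closure D
  interior_nonempty : ∀ i, (interior (K i)).Nonempty
  interior_subset : ∀ i, interior (K i) ⊆ D
  cover : D ⊆ ⋃ i, K i
  disjoint : Pairwise fun i j => Disjoint (interior (K i)) (interior (K j))
  frontier_null : ∀ i, volume (frontier (K i)) = 0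
  cone : ∀ i, ConeCondition (interior (K i))

/-- `κ̃ = ∑ |∇χ_j|²`. -/
def weight {d Nc : ℕ} (χ : Fin Nc → Vec d → ℝ) (x : Vec d) : ℝ :=
  ∑ j, ‖gradient (χ j) x‖ ^ 2

/-- A partition of unity on `D` with bounded gradients, for which `κ̃` is an admissible weight. -/
structure IsPartitionOfUnity {d Nc : ℕ} (D : Set (Vec d)) (χ : Fin Nc → Vec d → ℝ) : Prop where
  locallyLipschitz : ∀ j, LocallyLipschitzOn D (χ j)
  bounded_gradient : ∃ M : ℝ, ∀ j, ∀ᵐ x ∂(volume.restrict D), ‖gradient (χ j) x‖ ≤ M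
  nonneg : ∀ j, ∀ x ∈ D, 0 ≤ χ j x
  le_one : ∀ j, ∀ x ∈ D, χ j x ≤ 1
  sum_eq_one : ∀ x ∈ D, ∑ j, χ j x = 1
  weight_pos : ∀ᵐ x ∂(volume.restrict D), 0 < weight χ x

/-- `(φ, lam)` is an eigenpair of the local spectral problem on `K`. -/
def IsEigenpair {d : ℕ} (D K : Set (Vec d)) (κ : Vec d → ℝ)
    (φ : SobPair d ((volume.restrict D).restrict K)) (lam : ℝ) : Prop :=
  φ ∈ VLoc D K ∧ ∀ v ∈ VLoc D K, aForm φ v = lam * sForm κ φ v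

/-- `(φ j, lam j)`, `j = 0, 1, 2, …`, lists all the eigenpairs of the local spectral problem on
`K` in ascending order of the eigenvalues, every eigenvalue being repeated according to its
multiplicity, with eigenfunctions that are orthonormal for `∫_K κ u · v`. -/
structure IsEigenSystem {d : ℕ} (D K : Set (Vec d)) (κ : Vec d → ℝ)
    (φ : ℕ → SobPair d ((volume.restrict D).restrict K)) (lam : ℕ → ℝ) : Prop where
  eigenpair : ∀ j, IsEigenpair D K κ (φ j) (lam j)
  orthonormal : ∀ j k, sForm κ (φ j) (φ k) = if j = k then 1 else 0
  mono : Monotone lam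
  exhaustive : ∀ ψ m, IsEigenpair D K κ ψ m → ψ ∈ Submodule.span ℝ (φ '' {j | lam j = m})

/-- The data of the multiscale method. -/
structure Setting (d : ℕ) where
  /-- the domain `Ω` -/
  Ω : Set (Vec d)
  /-- the perforations -/
  B : Set (Vec d)
  Ω_open : IsOpen Ω
  Ω_connected : IsConnected Ω
  Ω_bounded : Bornology.IsBounded Ω
  /-- the number of coarse blocks -/
  N : ℕ
  /-- the coarse blocks -/
  K : Fin N → Set (Vec d)
  grid : IsCoarseGrid (Ω \ closure B) K
  /-- the number of coarse nodes -/
  Nc : ℕ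
  /-- the partition of unity -/
  χ : Fin Nc → Vec d → ℝ
  partition : IsPartitionOfUnity (Ω \ closure B) χ
  /-- the local eigenfunctions, numbered from `0` -/
  φ : (i : Fin N) → ℕ → SobPair d ((volume.restrict (Ω \ closure B)).restrict (K i))
  /-- the local eigenvalues, numbered from `0` -/
  lam : Fin N → ℕ → ℝ
  eigen : ∀ i, IsEigenSystem (Ω \ closure B) (K i) (weight χ) (φ i) (lam i)
  /-- `ℓ i` is the number of eigenfunctions selected on the block `K i` -/
  ℓ : Fin N → ℕ

namespace Setting

variable {d : ℕ} (S : Setting d)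

/-- The perforated domain `Ω^ε`. -/
abbrev dom : Set (Vec d) := S.Ω \ closure S.B

/-- Lebesgue measure on the perforated domain. -/
abbrev vol : Measure (Vec d) := volume.restrict (S.Ω \ closure S.B)

/-- `κ̃`. -/
def κ : Vec d → ℝ := weight S.χ

/-- The coarse grid size `H`, the largest diameter of a coarse block. -/
def H : ℝ := ⨆ i, Metric.diam (S.K i)

/-- `Λ`, the smallest of the first discarded eigenvalues (number `ℓ i` when counting from `0`). -/
def Λ : ℝ := ⨅ i, S.lam i (S.ℓ i)

/-- Families of fields on the coarse blocks; `V_aux = ⨁ V_aux^i` consists of such families. -/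
abbrev Broken : Type := (i : Fin S.N) → SobPair d (S.vol.restrict (S.K i))

/-- `s(u, v) = ∑_i s_i(u, v)`. -/
def s (u v : S.Broken) : ℝ := ∑ i, sForm S.κ (u i) (v i)

/-- `φ_j^i` as an element of `V_aux`. -/
def auxBasis (i : Fin S.N) (j : ℕ) : S.Broken := Pi.single i (S.φ i j)

/-- The projection `π : V_0 → V_aux`. -/
def proj (v : SobPair d S.vol) : S.Broken := fun i =>
  ∑ j ∈ Finset.range (S.ℓ i), sForm S.κ (restr S.vol (S.K i) v) (S.φ i j) • S.φ i j

/-- The functional `a(ψ, ψ) + s(π ψ - φ_j^i, π ψ - φ_j^i)`. -/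
def cemEnergy (i : Fin S.N) (j : ℕ) (ψ : SobPair d S.vol) : ℝ :=
  aForm ψ ψ + S.s (S.proj ψ - S.auxBasis i j) (S.proj ψ - S.auxBasis i j)

/-- `ψ` is the global multiscale basis function `ψ_j^i`. -/
def IsGlobalBasis (i : Fin S.N) (j : ℕ) (ψ : SobPair d S.vol) : Prop :=
  ψ ∈ V0div S.dom ∧ IsMinOn (S.cemEnergy i j) (V0div S.dom) ψ

/-- `V_glo`, the span of the global multiscale basis functions. -/
def Vglo : Submodule ℝ (SobPair d S.vol) :=
  Submodule.span ℝ {ψ | ∃ (i : Fin S.N) (j : ℕ), j < S.ℓ i ∧ S.IsGlobalBasis i j ψ}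

/-- `(u, p) ∈ H¹₀ × L²₀` is the weak solution of the Stokes problem with body force `f`. -/
structure IsStokesSolution (f : Lp (Vec d) 2 S.vol) (u : SobPair d S.vol)
    (p : Lp ℝ 2 S.vol) : Prop where
  mem : u ∈ V0 S.dom
  mean_zero : ∫ x, p x ∂S.vol = 0
  momentum : ∀ v ∈ V0 S.dom, aForm u v - bForm v p = inner ℝ f v.fst
  mass : ∀ q : Lp ℝ 2 S.vol, ∫ x, q x ∂S.vol = 0 → bForm u q = 0

/-- `w` is the Galerkin solution in `V_glo`. -/
structure IsGlobalSolution (f : Lp (Vec d) 2 S.vol) (w : SobPair d S.vol) : Prop where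
  mem : w ∈ S.Vglo
  galerkin : ∀ v ∈ S.Vglo, aForm w v = inner ℝ f v.fst

end Setting

/-- The multilinear shape function of the corner `σ` of the unit cube `[0, 1]^d`. -/
def shape {d : ℕ} (σ : Fin d → Bool) (t : Fin d → ℝ) : ℝ :=
  ∏ k, if σ k then t k else 1 - t k

/-- The multilinear map of the unit cube that sends the corner `σ` to `P σ`. -/
def cellMap {d : ℕ} (P : (Fin d → Bool) → Vec d) (t : Fin d → ℝ) : Vec d :=
  ∑ σ, shape σ t • P σ

/-- The partition of unity is the bilinear (in `ℝ^d`, multilinear) one: the block `K i` is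
contained in a cell, the one-to-one image of the unit cube under a multilinear map; the corners of
the cells are the nodes `x_j`; and on `K i` the function `χ_j` is the shape function of `x_j` if
`x_j` is a corner of the cell, and `0` otherwise. The diameters of the cells (that is, of their sets
of corners) are at most `ρ * H`; if the corners belong to the blocks this holds with `ρ = 1`. -/
def Setting.IsBilinear {d : ℕ} (S : Setting d) (ρ : ℝ) : Prop :=
  ∃ (node : Fin S.Nc → Vec d) (corner : Fin S.N → (Fin d → Bool) → Fin S.Nc), ∀ i,
    InjOn (cellMap fun σ => node (corner i σ)) (Icc 0 1) ∧
    S.K i ⊆ (cellMap fun σ => node (corner i σ)) '' Icc 0 1 ∧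
    (∀ σ τ, dist (node (corner i σ)) (node (corner i τ)) ≤ ρ * S.H) ∧
    ∀ t ∈ Icc (0 : Fin d → ℝ) 1, (cellMap fun σ => node (corner i σ)) t ∈ S.K i ∩ S.dom →
      ∀ j, S.χ j (cellMap (fun σ => node (corner i σ)) t) =
        ∑ σ, if corner i σ = j then shape σ t else 0

end StokesCEM

end

/-! Write e = u - u_glo. Both fields are divergence-free, so the pressure drops out of every test
with a divergence-free field, and Galerkin orthogonality gives a(e, v) = 0 on `Vglo` and a(e, e) =
⟨f, e⟩ (`aForm_error_eq`).

The basis functions are built so that a-orthogonality to `Vglo` forces π e = 0. The normal equations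
of the minimization read a(ψ_k, v) = s(φ_k - π ψ_k, π v). Combining them with the coefficients of π
e and testing once with e and once with the combination itself leaves a vanishing sum of two squares
(`apply_eq_zero_of_orthogonal_minimizers`, `sForm_error_eq_zero`).

On each block e is therefore s_i-orthogonal to the first ℓ_i eigenfunctions, and the min-max
principle gives λ s_i(e, e) ≤ a_i(e, e) with λ the first discarded eigenvalue. Summation over the
blocks yields Λ s(e, e) ≤ a(e, e) (`Λ_mul_sForm_error_le`). Splitting f · e into κ^(-1/2) f and
κ^(1/2) e, Cauchy–Schwarz turns a(e, e) = ⟨f, e⟩ into the weighted estimate, with constant 1.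

The min-max inequality rests on the assumption that the given list contains all eigenpairs: a
minimizer of the Rayleigh quotient on the complement of the first l eigenvectors is itself an
eigenvector, hence is listed, hence its eigenvalue is at least number l (`eigenvalue_mul_le`).
Existence of that minimizer needs the compact embedding of V(K) into L², which is Rellich's theorem
on a set with the cone condition (`exists_subseq_tendsto_lintegral_sub_sq`).

For the multilinear partition of unity, the shape functions reproduce the coordinates from corners
at mutual distance at most ρ H. Differentiating this identity bounds κ below by a multiple of
H^(-2), which converts the weighted norm of f into H ‖f‖. -/

namespace StokesCEM
open Filter Topology ENNReal

/-! ### Rellich compactness under the cone condition -/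

/-- A bounded sequence in a separable Hilbert space has a weakly convergent subsequence. -/
theorem exists_weakly_convergent_subseq {E : Type*} [NormedAddCommGroup E] [InnerProductSpace ℝ E]
    [CompleteSpace E] [TopologicalSpace.SeparableSpace E] (u : ℕ → E) (M : ℝ)
    (hu : ∀ n, ‖u n‖ ≤ M) :
    ∃ φ : ℕ → ℕ, StrictMono φ ∧
      ∀ g : E, ∃ l : ℝ, Tendsto (fun n => inner ℝ (u (φ n)) g) atTop (𝓝 l) := by
  -- Sequential Banach–Alaoglu; the Riesz isometry carries the sequence into the dual.
  have h := WeakDual.isSeqCompact_closedBall ℝ E (0 : StrongDual ℝ E) M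
  have hx : ∀ n, StrongDual.toWeakDual (InnerProductSpace.toDual ℝ E (u n)) ∈
      WeakDual.toStrongDual ⁻¹' Metric.closedBall (0 : StrongDual ℝ E) M := fun n => by
    simpa using hu n
  obtain ⟨a, -, φ, hφ, hlim⟩ := h hx
  refine ⟨φ, hφ, fun g => ⟨a g, ?_⟩⟩
  have := (WeakDual.eval_continuous (𝕜 := ℝ) g).tendsto a |>.comp hlim
  simpa [Function.comp_def] using this

/-- Cauchy–Schwarz against the constant 1. Working in `ℝ≥0∞` avoids all integrability conditions. -/
theorem enorm_integral_sq_le {α E : Type*} [MeasurableSpace α] [NormedAddCommGroup E]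
    [NormedSpace ℝ E] (μ : Measure α) (g : α → E) (hg : AEStronglyMeasurable g μ) :
    ‖∫ x, g x ∂μ‖ₑ ^ 2 ≤ μ univ * ∫⁻ x, ‖g x‖ₑ ^ 2 ∂μ := by
  have h1 : ‖∫ x, g x ∂μ‖ₑ ≤ ∫⁻ x, 1 * ‖g x‖ₑ ∂μ := by
    simpa using enorm_integral_le_lintegral_enorm g
  have h2 := ENNReal.lintegral_mul_le_Lp_mul_Lq μ (p := 2) (q := 2)
    Real.HolderConjugate.two_two (f := fun _ => 1) (g := fun x => ‖g x‖ₑ)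
    aemeasurable_const hg.enorm
  have h3 := pow_le_pow_left₀ zero_le (h1.trans h2) 2
  refine h3.trans_eq ?_
  rw [mul_pow, ← ENNReal.rpow_mul_natCast, ← ENNReal.rpow_mul_natCast]
  norm_num

theorem ennreal_add_sq_le (a b : ℝ≥0∞) : (a + b) ^ 2 ≤ 2 * (a ^ 2 + b ^ 2) := by
  have := ENNReal.rpow_add_le_mul_rpow_add_rpow a b (p := 2) (by norm_num)
  norm_num at this
  exact_mod_cast this

/-- The increment is the integral of the derivative along the segment from x to x + z.
Cauchy–Schwarz in the parameter t, Tonelli and translation invariance do the rest, since each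
translate of `S` stays in `G`. -/
theorem lintegral_translate_sub_sq_le {d : ℕ} {F : Type*} [NormedAddCommGroup F]
    [NormedSpace ℝ F] [CompleteSpace F] (w : Vec d → F) (hw : ContDiff ℝ 1 w)
    (S G : Set (Vec d)) (z : Vec d)
    (hS : ∀ x ∈ S, ∀ t ∈ Icc (0 : ℝ) 1, x + t • z ∈ G) :
    ∫⁻ x in S, ‖w (x + z) - w x‖ₑ ^ 2 ≤ ‖z‖ₑ ^ 2 * ∫⁻ x in G, ‖fderiv ℝ w x‖ₑ ^ 2 := by
  have hc : Continuous (fderiv ℝ w) := hw.continuous_fderiv (by norm_num)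
  have h1 : ∀ x, ‖w (x + z) - w x‖ₑ ^ 2 ≤
      ∫⁻ t in Icc (0 : ℝ) 1, ‖z‖ₑ ^ 2 * ‖fderiv ℝ w (x + t • z)‖ₑ ^ 2 := by
    intro x
    have hd : ∀ t ∈ uIcc (0 : ℝ) 1,
        HasDerivAt (fun t : ℝ => w (x + t • z)) (fderiv ℝ w (x + t • z) z) t := by
      intro t _
      have ha : HasDerivAt (fun t : ℝ => x + t • z) z t := by
        simpa using ((hasDerivAt_id t).smul_const z).const_add x
      exact ((hw.differentiable (by norm_num)).differentiableAt.hasFDerivAt).comp_hasDerivAt t ha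
    have hcont : Continuous fun t : ℝ => fderiv ℝ w (x + t • z) z := by fun_prop
    have hi := intervalIntegral.integral_eq_sub_of_hasDerivAt hd
      (hcont.intervalIntegrable _ _)
    rw [intervalIntegral.integral_of_le zero_le_one, ← integral_Icc_eq_integral_Ioc] at hi
    simp only [one_smul, zero_smul, add_zero] at hi
    rw [← hi]
    refine (enorm_integral_sq_le _ _ hcont.aestronglyMeasurable).trans ?_
    simp only [Measure.restrict_apply_univ, Real.volume_Icc, sub_zero, ENNReal.ofReal_one, one_mul]
    refine lintegral_mono fun t => ?_
    rw [← mul_pow]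
    refine pow_le_pow_left₀ zero_le ?_ 2
    rw [mul_comm]
    exact ContinuousLinearMap.le_opENorm _ _
  calc ∫⁻ x in S, ‖w (x + z) - w x‖ₑ ^ 2
      ≤ ∫⁻ x in S, ∫⁻ t in Icc (0 : ℝ) 1, ‖z‖ₑ ^ 2 * ‖fderiv ℝ w (x + t • z)‖ₑ ^ 2 :=
        lintegral_mono h1
    _ = ∫⁻ t in Icc (0 : ℝ) 1, ∫⁻ x in S, ‖z‖ₑ ^ 2 * ‖fderiv ℝ w (x + t • z)‖ₑ ^ 2 := by
        refine lintegral_lintegral_swap (Measurable.aemeasurable ?_)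
        have h2 : Measurable fun p : Vec d × ℝ => ‖fderiv ℝ w (p.1 + p.2 • z)‖ₑ :=
          (hc.comp (by fun_prop)).enorm.measurable
        exact (h2.pow_const 2).const_mul _
    _ ≤ ∫⁻ t in Icc (0 : ℝ) 1, ‖z‖ₑ ^ 2 * ∫⁻ x in G, ‖fderiv ℝ w x‖ₑ ^ 2 := by
        refine setLIntegral_mono' measurableSet_Icc fun t ht => ?_
        rw [lintegral_const_mul _ (by fun_prop)]
        refine mul_le_mul' le_rfl ?_
        calc ∫⁻ x in S, ‖fderiv ℝ w (x + t • z)‖ₑ ^ 2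
            ≤ ∫⁻ x in (fun x => x + t • z) ⁻¹' G, ‖fderiv ℝ w (x + t • z)‖ₑ ^ 2 :=
              lintegral_mono_set fun x hx => hS x hx t ht
          _ = ∫⁻ x in G, ‖fderiv ℝ w x‖ₑ ^ 2 :=
              (measurePreserving_add_right volume (t • z)).setLIntegral_comp_preimage_emb
                (measurableEmbedding_addRight _) (fun y => ‖fderiv ℝ w y‖ₑ ^ 2) G
    _ = _ := by simp

/-- Split |C| w(x) into the integral of w over x + C and the integral of the increments w(x + z) -
w(x). The increments are controlled by r times the gradient, so only the local averages remain to be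
handled by weak convergence. -/
theorem lintegral_sq_le_average {d : ℕ} {F : Type*} [NormedAddCommGroup F]
    [NormedSpace ℝ F] [CompleteSpace F] [SecondCountableTopology F]
    (w : Vec d → F) (hw : ContDiff ℝ 1 w)
    (S G C : Set (Vec d)) (hC : IsCompact C) (r : ℝ) (hr : ∀ z ∈ C, ‖z‖ ≤ r)
    (hS : ∀ x ∈ S, ∀ z ∈ C, ∀ t ∈ Icc (0 : ℝ) 1, x + t • z ∈ G) :
    volume C ^ 2 * ∫⁻ x in S, ‖w x‖ₑ ^ 2 ≤
      2 * (∫⁻ x in S, ‖∫ z in C, w (x + z)‖ₑ ^ 2) +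
        2 * (volume C ^ 2 * (ENNReal.ofReal r ^ 2 * ∫⁻ x in G, ‖fderiv ℝ w x‖ₑ ^ 2)) := by
  have hfin : volume C ≠ ⊤ := hC.measure_ne_top
  have hcw : Continuous w := hw.continuous
  have hi : ∀ x, IntegrableOn (fun z => w (x + z)) C := fun x =>
    (hcw.comp (continuous_const.add continuous_id)).continuousOn.integrableOn_compact hC
  have hmeasavg : Measurable fun x => ‖∫ z in C, w (x + z)‖ₑ ^ 2 := by
    refine Measurable.pow_const (StronglyMeasurable.enorm ?_) 2
    refine StronglyMeasurable.integral_prod_right' (f := fun p : Vec d × Vec d => w (p.1 + p.2)) ?_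
    exact (hcw.comp (by fun_prop)).stronglyMeasurable
  have hpt : ∀ x, volume C ^ 2 * ‖w x‖ₑ ^ 2 ≤ 2 * ‖∫ z in C, w (x + z)‖ₑ ^ 2 +
      2 * (volume C * ∫⁻ z in C, ‖w (x + z) - w x‖ₑ ^ 2) := by
    intro x
    have h1 : (volume C).toReal • w x =
        (∫ z in C, w (x + z)) - ∫ z in C, (w (x + z) - w x) := by
      rw [integral_sub (hi x) (integrableOn_const hfin)]
      simp [Measure.real]
    have h2 : volume C * ‖w x‖ₑ ≤
        ‖∫ z in C, w (x + z)‖ₑ + ‖∫ z in C, (w (x + z) - w x)‖ₑ := by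
      refine le_trans (le_of_eq ?_) (h1 ▸ enorm_sub_le :
        ‖(volume C).toReal • w x‖ₑ ≤ _)
      rw [enorm_smul, Real.enorm_eq_ofReal ENNReal.toReal_nonneg, ENNReal.ofReal_toReal hfin]
    rw [← mul_pow, ← mul_add]
    refine (pow_le_pow_left₀ zero_le h2 2).trans ((ennreal_add_sq_le _ _).trans ?_)
    gcongr
    refine (enorm_integral_sq_le _ _ ?_).trans_eq (by rw [Measure.restrict_apply_univ])
    exact Continuous.aestronglyMeasurable (by fun_prop)
  calc volume C ^ 2 * ∫⁻ x in S, ‖w x‖ₑ ^ 2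
      = ∫⁻ x in S, volume C ^ 2 * ‖w x‖ₑ ^ 2 := by
        rw [lintegral_const_mul _ (hcw.enorm.measurable.pow_const 2)]
    _ ≤ ∫⁻ x in S, (2 * ‖∫ z in C, w (x + z)‖ₑ ^ 2 +
      2 * (volume C * ∫⁻ z in C, ‖w (x + z) - w x‖ₑ ^ 2)) := lintegral_mono hpt
    _ = 2 * (∫⁻ x in S, ‖∫ z in C, w (x + z)‖ₑ ^ 2) +
        2 * (volume C * ∫⁻ x in S, ∫⁻ z in C, ‖w (x + z) - w x‖ₑ ^ 2) := by
        have hm : Measurable fun x => ∫⁻ z in C, ‖w (x + z) - w x‖ₑ ^ 2 := by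
          refine Measurable.lintegral_prod_right'
            (f := fun p : Vec d × Vec d => ‖w (p.1 + p.2) - w p.1‖ₑ ^ 2) ?_
          exact Continuous.measurable (by fun_prop)
        rw [lintegral_add_left (hmeasavg.const_mul 2), lintegral_const_mul _ hmeasavg,
          lintegral_const_mul _ (hm.const_mul _), lintegral_const_mul _ hm]
    _ ≤ _ := by
        refine add_le_add le_rfl (mul_le_mul' le_rfl ?_)
        rw [pow_two, mul_assoc]
        refine mul_le_mul' le_rfl ?_
        rw [lintegral_lintegral_swap (Continuous.aemeasurable (by fun_prop))]
        calc ∫⁻ z in C, ∫⁻ x in S, ‖w (x + z) - w x‖ₑ ^ 2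
            ≤ ∫⁻ z in C, ENNReal.ofReal r ^ 2 * ∫⁻ x in G, ‖fderiv ℝ w x‖ₑ ^ 2 := by
              refine setLIntegral_mono' hC.measurableSet fun z hz => ?_
              refine (lintegral_translate_sub_sq_le w hw S G z
                fun x hx t ht => hS x hx z hz t ht).trans ?_
              gcongr
              rw [← ofReal_norm]
              exact ENNReal.ofReal_le_ofReal (hr z hz)
          _ = _ := by simp [mul_comm]

theorem lintegral_sub_sq_le {d : ℕ} {H : Type*} [NormedAddCommGroup H] (μ : Measure (Vec d))
    (M : ℝ≥0∞) (f g : Vec d → H) (hf : Continuous f) (hg : Continuous g)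
    (hfM : ∫⁻ x, ‖f x‖ₑ ^ 2 ∂μ ≤ M) (hgM : ∫⁻ x, ‖g x‖ₑ ^ 2 ∂μ ≤ M) :
    ∫⁻ x, ‖f x - g x‖ₑ ^ 2 ∂μ ≤ 4 * M := by
  calc ∫⁻ x, ‖f x - g x‖ₑ ^ 2 ∂μ
      ≤ ∫⁻ x, 2 * (‖f x‖ₑ ^ 2 + ‖g x‖ₑ ^ 2) ∂μ := lintegral_mono fun x =>
        (pow_le_pow_left₀ zero_le enorm_sub_le 2).trans (ennreal_add_sq_le _ _)
    _ = 2 * ((∫⁻ x, ‖f x‖ₑ ^ 2 ∂μ) + ∫⁻ x, ‖g x‖ₑ ^ 2 ∂μ) := by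
        have hf' : Measurable fun x => ‖f x‖ₑ ^ 2 := hf.enorm.measurable.pow_const 2
        have hg' : Measurable fun x => ‖g x‖ₑ ^ 2 := hg.enorm.measurable.pow_const 2
        rw [← lintegral_add_left hf']
        exact lintegral_const_mul _ (hf'.add hg')
    _ ≤ 2 * (M + M) := by gcongr
    _ = 4 * M := by rw [← two_mul, ← mul_assoc]; norm_num

/-- The oscillation part of `lintegral_sq_le_average` is small uniformly in the sequence once r is
small. With r fixed, the averages converge pointwise and are uniformly bounded on a set of finite
measure, so dominated convergence applies to their differences. -/
theorem tendsto_lintegral_sub_sq {d : ℕ} {F : Type*} [NormedAddCommGroup F]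
    [NormedSpace ℝ F] [CompleteSpace F] [SecondCountableTopology F]
    (v : ℕ → Vec d → F) (hv : ∀ n, ContDiff ℝ 1 (v n))
    (S G : Set (Vec d)) (hSm : MeasurableSet S) (hSG : S ⊆ G) (hG : volume G ≠ ⊤) (M : ℝ≥0∞) (hM : M ≠ ⊤)
    (h1 : ∀ n, ∫⁻ x in G, ‖v n x‖ₑ ^ 2 ≤ M)
    (h2 : ∀ n, ∫⁻ x in G, ‖fderiv ℝ (v n) x‖ₑ ^ 2 ≤ M)
    (hcone : ∀ r : ℝ, 0 < r → ∃ C : Set (Vec d), IsCompact C ∧ volume C ≠ 0 ∧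
      (∀ z ∈ C, ‖z‖ ≤ r) ∧ (∀ x ∈ S, ∀ z ∈ C, ∀ t ∈ Icc (0 : ℝ) 1, x + t • z ∈ G) ∧
      ∀ x ∈ S, ∃ l, Tendsto (fun n => ∫ z in C, v n (x + z)) atTop (𝓝 l)) :
    Tendsto (fun p : ℕ × ℕ => ∫⁻ x in S, ‖v p.1 x - v p.2 x‖ₑ ^ 2) atTop (𝓝 0) := by
  have hc : ∀ n, Continuous (v n) := fun n => (hv n).continuous
  rw [ENNReal.tendsto_nhds_zero]
  intro ε hε
  -- The radius is fixed before the indices: it makes the gradient contribution at most ε/2 for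
  -- every pair, 4M being the bound for differences of two members of the sequence.
  obtain ⟨r, hr0, hr⟩ : ∃ r : ℝ, 0 < r ∧ 2 * (ENNReal.ofReal r ^ 2 * (4 * M)) ≤ ε / 2 := by
    have ht : Tendsto (fun r : ℝ => 2 * (ENNReal.ofReal r ^ 2 * (4 * M))) (𝓝[>] 0) (𝓝 0) := by
      have h0 : Tendsto (fun r : ℝ => ENNReal.ofReal r ^ 2) (𝓝[>] 0) (𝓝 0) := by
        have : Continuous fun r : ℝ => ENNReal.ofReal r ^ 2 :=
          (ENNReal.continuous_pow 2).comp ENNReal.continuous_ofReal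
        simpa using (this.tendsto 0).mono_left nhdsWithin_le_nhds
      have h3 := ENNReal.Tendsto.const_mul (a := 2) (ENNReal.Tendsto.mul_const (b := 4 * M) h0
        (Or.inr (ENNReal.mul_ne_top (by norm_num) hM))) (Or.inr (by norm_num))
      simpa using h3
    have h3 := (ENNReal.tendsto_nhds_zero.1 ht (ε / 2) (ENNReal.half_pos hε.ne')).and
      self_mem_nhdsWithin
    obtain ⟨r, hr, hr0⟩ := h3.exists
    exact ⟨r, hr0, hr⟩
  obtain ⟨C, hC, hC0, hCr, hCS, hlim⟩ := hcone r hr0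
  have hCt : volume C ≠ ⊤ := hC.measure_ne_top
  have hJ : Tendsto (fun p : ℕ × ℕ => ∫⁻ x in S, ‖∫ z in C, (v p.1 (x + z) - v p.2 (x + z))‖ₑ ^ 2)
      atTop (𝓝 0) := by
    have h0 : (0 : ℝ≥0∞) = ∫⁻ x in S, 0 := by simp
    rw [h0]
    refine tendsto_lintegral_filter_of_dominated_convergence
      (fun _ => volume C * (4 * M)) ?_ ?_ ?_ ?_
    · refine Eventually.of_forall fun p => Measurable.pow_const (StronglyMeasurable.enorm ?_) 2
      refine StronglyMeasurable.integral_prod_right'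
        (f := fun q : Vec d × Vec d => v p.1 (q.1 + q.2) - v p.2 (q.1 + q.2)) ?_
      exact Continuous.stronglyMeasurable (by fun_prop)
    · refine Eventually.of_forall fun p => (ae_restrict_iff' hSm).2 (ae_of_all _ fun x hx => ?_)
      refine (enorm_integral_sq_le _ _ (Continuous.aestronglyMeasurable (by fun_prop))).trans ?_
      rw [Measure.restrict_apply_univ]
      refine mul_le_mul' le_rfl ?_
      calc ∫⁻ z in C, ‖v p.1 (x + z) - v p.2 (x + z)‖ₑ ^ 2
          ≤ ∫⁻ z in (fun z => x + z) ⁻¹' G, ‖v p.1 (x + z) - v p.2 (x + z)‖ₑ ^ 2 :=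
            lintegral_mono_set fun z hz => by
              simpa using hCS x hx z hz 1 (by simp)
        _ = ∫⁻ y in G, ‖v p.1 y - v p.2 y‖ₑ ^ 2 :=
            (measurePreserving_add_left volume x).setLIntegral_comp_preimage_emb
              (measurableEmbedding_addLeft _) (fun y => ‖v p.1 y - v p.2 y‖ₑ ^ 2) G
        _ ≤ 4 * M := lintegral_sub_sq_le _ M _ _ (hc _) (hc _) (h1 _) (h1 _)
    · simp only [lintegral_const, Measure.restrict_apply_univ]
      exact ENNReal.mul_ne_top (ENNReal.mul_ne_top hCt (ENNReal.mul_ne_top (by norm_num) hM))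
        (ne_top_of_le_ne_top hG (measure_mono hSG))
    · refine (ae_restrict_iff' hSm).2 (ae_of_all _ fun x hx => ?_)
      obtain ⟨l, hl⟩ := hlim x hx
      have hi : ∀ n, IntegrableOn (fun z => v n (x + z)) C := fun n =>
        ((hc n).comp (continuous_const.add continuous_id)).continuousOn.integrableOn_compact hC
      have h3 : Tendsto (fun p : ℕ × ℕ => (∫ z in C, v p.1 (x + z)) - ∫ z in C, v p.2 (x + z))
          atTop (𝓝 (l - l)) := by
        rw [← prod_atTop_atTop_eq]
        exact (hl.comp tendsto_fst).sub (hl.comp tendsto_snd)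
      have h4 := (ENNReal.continuous_pow 2).tendsto _ |>.comp h3.enorm
      simp only [sub_self, enorm_zero] at h4
      refine Tendsto.congr (fun p => ?_) (by simpa [Function.comp_def] using h4)
      rw [integral_sub (hi _) (hi _)]
  have hVC : volume C ^ 2 ≠ 0 := pow_ne_zero 2 hC0
  have hVCt : volume C ^ 2 ≠ ⊤ := ENNReal.pow_ne_top hCt
  have hev := ENNReal.tendsto_nhds_zero.1 hJ (volume C ^ 2 * (ε / 4))
    (ENNReal.mul_pos hVC (ENNReal.div_pos hε.ne' (by norm_num)).ne')
  filter_upwards [hev] with p hp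
  have h4 := lintegral_sq_le_average (fun x => v p.1 x - v p.2 x) ((hv _).sub (hv _)) S G C hC r
    hCr hCS
  have hfd : ∫⁻ x in G, ‖fderiv ℝ (fun x => v p.1 x - v p.2 x) x‖ₑ ^ 2 ≤ 4 * M := by
    have := lintegral_sub_sq_le _ M _ _ ((hv p.1).continuous_fderiv (by norm_num))
      ((hv p.2).continuous_fderiv (by norm_num)) (h2 p.1) (h2 p.2)
    refine le_trans (le_of_eq (lintegral_congr fun x => ?_)) this
    rw [fderiv_fun_sub ((hv _).differentiable (by norm_num)).differentiableAt
      ((hv _).differentiable (by norm_num)).differentiableAt]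
  rw [← ENNReal.mul_le_mul_iff_right hVC hVCt]
  calc volume C ^ 2 * ∫⁻ x in S, ‖v p.1 x - v p.2 x‖ₑ ^ 2
      ≤ 2 * (volume C ^ 2 * (ε / 4)) + 2 * (volume C ^ 2 * (ENNReal.ofReal r ^ 2 * (4 * M))) :=
        h4.trans (by gcongr)
    _ = volume C ^ 2 * (2 * (ε / 4)) + volume C ^ 2 * (2 * (ENNReal.ofReal r ^ 2 * (4 * M))) := by
        ring
    _ ≤ volume C ^ 2 * (ε / 2) + volume C ^ 2 * (ε / 2) := by
        gcongr
        rw [← ENNReal.mul_div_mul_left ε 2 (c := 2) (by norm_num) (by norm_num)]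
        rw [mul_div_assoc]
        norm_num
    _ = volume C ^ 2 * ε := by rw [← mul_add, ENNReal.add_halves]

/-- A closed spherical cone with vertex `0`, truncated at height `r`. -/
def truncCone {d : ℕ} (ξ : Vec d) (c r : ℝ) : Set (Vec d) :=
  {z | ‖z‖ ≤ r ∧ c * ‖z‖ ≤ inner ℝ ξ z}

theorem isCompact_truncCone {d : ℕ} (ξ : Vec d) (c r : ℝ) : IsCompact (truncCone ξ c r) := by
  refine Metric.isCompact_of_isClosed_isBounded ?_ ?_
  · exact (isClosed_le continuous_norm continuous_const).inter
      (isClosed_le (continuous_const.mul continuous_norm) (continuous_const.inner continuous_id))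
  · exact (Metric.isBounded_closedBall (x := (0 : Vec d)) (r := r)).subset
      fun z hz => by simpa using hz.1

theorem volume_truncCone_ne_zero {d : ℕ} {ξ : Vec d} (hξ : ‖ξ‖ = 1) {c r : ℝ} (hc : c < 1)
    (hr : 0 < r) : volume (truncCone ξ c r) ≠ 0 := by
  have ho : IsOpen {z : Vec d | ‖z‖ < r ∧ c * ‖z‖ < inner ℝ ξ z} :=
    (isOpen_lt continuous_norm continuous_const).inter 
      (isOpen_lt (continuous_const.mul continuous_norm) (continuous_const.inner continuous_id))
  have hne : ({z : Vec d | ‖z‖ < r ∧ c * ‖z‖ < inner ℝ ξ z}).Nonempty := by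
    refine ⟨(r / 2) • ξ, ?_, ?_⟩
    · rw [norm_smul, hξ, Real.norm_of_nonneg (by positivity)]; linarith
    · rw [norm_smul, hξ, Real.norm_of_nonneg (by positivity), inner_smul_right,
        real_inner_self_eq_norm_sq, hξ]
      nlinarith
  have hsub : {z : Vec d | ‖z‖ < r ∧ c * ‖z‖ < inner ℝ ξ z} ⊆ truncCone ξ c r :=
    fun z hz => ⟨hz.1.le, hz.2.le⟩
  exact ((ho.measure_pos volume hne).trans_le (measure_mono hsub)).ne'

theorem smul_mem_truncCone {d : ℕ} {ξ z : Vec d} {c r t : ℝ} (hz : z ∈ truncCone ξ c r)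
    (ht : t ∈ Icc (0 : ℝ) 1) : t • z ∈ truncCone ξ c r := by
  obtain ⟨h1, h2⟩ := hz
  refine ⟨?_, ?_⟩
  · rw [norm_smul, Real.norm_of_nonneg ht.1]
    nlinarith [norm_nonneg z, ht.1, ht.2]
  · rw [norm_smul, Real.norm_of_nonneg ht.1, inner_smul_right]
    nlinarith [ht.1, ht.2]

/-- Finitely many directions suffice in the cone condition. -/
theorem ConeCondition.exists_finset {d : ℕ} {G : Set (Vec d)} (h : ConeCondition G) :
    ∃ (T : Finset (Vec d)) (c r : ℝ), c < 1 ∧ 0 < r ∧ (∀ ξ ∈ T, ‖ξ‖ = 1) ∧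
      ∀ x ∈ G, ∃ ξ ∈ T, ∀ z ∈ truncCone ξ c r, x + z ∈ G := by
  obtain ⟨c, h, hc0, hc1, hh, H⟩ := h
  obtain ⟨T, hT, hTf, hcov⟩ := (isCompact_sphere (0 : Vec d) 1).finite_cover_balls
    (e := (1 - c) / 2) (by linarith)
  -- Replacing ξ by a net point η at distance less than (1 - c)/2 costs at most (1 - c)/2 · ‖z‖ in
  -- the inner product, and (1 + c)/2 - (1 - c)/2 = c. Halving the height makes the closed bound ‖z‖
  -- ≤ h/2 imply the strict one.
  refine ⟨hTf.toFinset, (1 + c) / 2, h / 2, by linarith, by linarith, ?_, ?_⟩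
  · intro ξ hξ
    simpa using hT (hTf.mem_toFinset.1 hξ)
  · intro x hx
    obtain ⟨ξ, hξ, Hξ⟩ := H x hx
    obtain ⟨η, hη, hξη⟩ := mem_iUnion₂.1 (hcov (show ξ ∈ Metric.sphere (0 : Vec d) 1 by simpa using hξ))
    refine ⟨η, hTf.mem_toFinset.2 hη, fun z hz => Hξ _ ?_ ?_⟩
    · rw [add_sub_cancel_left]; linarith [hz.1]
    · rw [add_sub_cancel_left]
      have h1 := hz.2
      have h2 : inner ℝ (η - ξ) z ≤ (1 - c) / 2 * ‖z‖ := by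
        refine (real_inner_le_norm _ _).trans ?_
        gcongr
        rw [Metric.mem_ball, dist_eq_norm, ← norm_neg, neg_sub] at hξη
        exact hξη.le
      rw [inner_sub_left] at h2
      linarith

theorem isOpen_forall_add_mem {d : ℕ} {G C : Set (Vec d)} (hG : IsOpen G) (hC : IsCompact C) :
    IsOpen {x | ∀ z ∈ C, x + z ∈ G} := by
  rw [isOpen_iff_mem_nhds]
  intro x hx
  refine hC.eventually_forall_of_forall_eventually fun z hz => ?_
  exact (hG.preimage (f := fun p : Vec d × Vec d => p.1 + p.2) (by fun_prop)).mem_nhds (hx z hz)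

/-- Each component of the integral over x + C is the pairing of `u n` with an indicator function
times a basis vector, so weak convergence suffices. -/
theorem tendsto_setIntegral_translate {d : ℕ} {G : Set (Vec d)} (u : ℕ → Lp (Vec d) 2 (volume.restrict G))
    (hu : ∀ g, ∃ l : ℝ, Tendsto (fun n => inner ℝ (u n) g) atTop (𝓝 l))
    (v : ℕ → Vec d → Vec d) (huv : ∀ n, u n =ᵐ[volume.restrict G] v n)
    (C : Set (Vec d)) (hC : IsCompact C) (x : Vec d) (hx : ∀ z ∈ C, x + z ∈ G) :
    ∃ l, Tendsto (fun n => ∫ z in C, v n (x + z)) atTop (𝓝 l) := by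
  set A : Set (Vec d) := (fun y => -x + y) ⁻¹' C with hA
  have hAm : MeasurableSet A := (measurable_const_add (-x)) hC.measurableSet
  have hAG : A ⊆ G := fun y hy => by simpa using hx _ hy
  have hAC : volume A = volume C := by rw [hA, measure_preimage_add]
  have hAf : volume.restrict G A ≠ ⊤ := ne_top_of_le_ne_top
    (hAC ▸ hC.measure_ne_top) (Measure.restrict_apply_le _ _)
  have hint : ∀ n, ∫ z in C, v n (x + z) = ∫ y in A, u n y ∂(volume.restrict G) := by
    intro n
    rw [Measure.restrict_restrict hAm, inter_eq_left.2 hAG]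
    have h1 : (fun y => u n y) =ᵐ[volume.restrict A] v n :=
      ae_restrict_of_ae_restrict_of_subset hAG (huv n)
    rw [integral_congr_ae h1]
    have h2 := (measurePreserving_add_left volume x).setIntegral_preimage_emb
      (measurableEmbedding_addLeft x) (v n) A
    rw [← h2]
    congr 2
    ext z
    simp [hA]
  choose l hl using fun i : Fin d =>
    hu (indicatorConstLp 2 hAm hAf (EuclideanSpace.single i (1 : ℝ)))
  refine ⟨WithLp.toLp 2 l, ?_⟩
  have h3 : Tendsto (fun n i => (∫ z in C, v n (x + z)) i) atTop (𝓝 l) := by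
    refine tendsto_pi_nhds.2 fun i => (hl i).congr fun n => ?_
    rw [real_inner_comm, L2.inner_indicatorConstLp_eq_inner_setIntegral, hint]
    simp [EuclideanSpace.inner_single_left]
  exact (PiLp.continuous_toLp 2 (fun _ : Fin d => ℝ)).tendsto l |>.comp h3

/-- **Rellich's theorem** for smooth fields on a bounded open set with the cone condition. -/
theorem exists_subseq_tendsto_lintegral_sub_sq {d : ℕ} {G : Set (Vec d)} (hG : IsOpen G)
    (hGb : Bornology.IsBounded G) (hcone : ConeCondition G) (v : ℕ → Vec d → Vec d)
    (hv : ∀ n, ContDiff ℝ 1 (v n)) (M : ℝ≥0∞) (hM : M ≠ ⊤)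
    (h1 : ∀ n, ∫⁻ x in G, ‖v n x‖ₑ ^ 2 ≤ M)
    (h2 : ∀ n, ∫⁻ x in G, ‖fderiv ℝ (v n) x‖ₑ ^ 2 ≤ M) :
    ∃ φ : ℕ → ℕ, StrictMono φ ∧
      Tendsto (fun p : ℕ × ℕ => ∫⁻ x in G, ‖v (φ p.1) x - v (φ p.2) x‖ₑ ^ 2) atTop (𝓝 0) := by
  have hmem : ∀ n, MemLp (v n) 2 (volume.restrict G) := fun n => by
    refine ⟨(hv n).continuous.aestronglyMeasurable, ?_⟩
    rw [eLpNorm_lt_top_iff_lintegral_rpow_enorm_lt_top (by norm_num) (by norm_num)]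
    simpa using (h1 n).trans_lt hM.lt_top
  have hnorm : ∀ n, ‖(hmem n).toLp (v n)‖ ≤ (M ^ (1 / 2 : ℝ)).toReal := fun n => by
    rw [Lp.norm_toLp]
    refine ENNReal.toReal_mono (ENNReal.rpow_ne_top_of_nonneg (by norm_num) hM) ?_
    rw [eLpNorm_eq_lintegral_rpow_enorm_toReal (by norm_num) (by norm_num)]
    simp only [ENNReal.toReal_ofNat, ENNReal.rpow_ofNat]
    exact ENNReal.rpow_le_rpow (h1 n) (by norm_num)
  have : Fact ((2 : ℝ≥0∞) ≠ ⊤) := ⟨by norm_num⟩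
  obtain ⟨φ, hφ, hlim⟩ := exists_weakly_convergent_subseq _ _ hnorm
  refine ⟨φ, hφ, ?_⟩
  obtain ⟨T, c, r, hc, hr, hT, hcov⟩ := hcone.exists_finset
  -- `S ξ` collects the points whose cone in the fixed direction ξ stays in `G`. On it one and the
  -- same averaging set serves all points, and finitely many such sets cover `G`.
  set S : T → Set (Vec d) := fun ξ => G ∩ {x | ∀ z ∈ truncCone (ξ : Vec d) c r, x + z ∈ G} with hS
  have hSlim : ∀ ξ : T, Tendsto (fun p : ℕ × ℕ =>
      ∫⁻ x in S ξ, ‖v (φ p.1) x - v (φ p.2) x‖ₑ ^ 2) atTop (𝓝 0) := by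
    intro ξ
    refine tendsto_lintegral_sub_sq (fun n => v (φ n)) (fun n => hv _) (S ξ) G
      (hG.inter (isOpen_forall_add_mem hG (isCompact_truncCone _ _ _))).measurableSet
      inter_subset_left hGb.measure_lt_top.ne M hM (fun n => h1 _) (fun n => h2 _) ?_
    intro ε hε
    have hsub : ∀ z ∈ truncCone (ξ : Vec d) c (min r ε), z ∈ truncCone (ξ : Vec d) c r :=
      fun z hz => ⟨hz.1.trans (min_le_left _ _), hz.2⟩
    refine ⟨truncCone ξ c (min r ε), isCompact_truncCone _ _ _,
      volume_truncCone_ne_zero (hT _ ξ.2) hc (lt_min hr hε),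
      fun z hz => hz.1.trans (min_le_right _ _),
      fun x hx z hz t ht => hx.2 _ (smul_mem_truncCone (hsub z hz) ht), fun x hx => ?_⟩
    exact tendsto_setIntegral_translate (fun n => (hmem (φ n)).toLp (v (φ n))) hlim _
      (fun n => (hmem (φ n)).coeFn_toLp) _ (isCompact_truncCone _ _ _) x
      fun z hz => hx.2 z (hsub z hz)
  have hsum : Tendsto (fun p : ℕ × ℕ =>
      ∑ ξ : T, ∫⁻ x in S ξ, ‖v (φ p.1) x - v (φ p.2) x‖ₑ ^ 2) atTop (𝓝 0) := by
    simpa using tendsto_finsetSum Finset.univ fun ξ _ => hSlim ξ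
  refine tendsto_of_tendsto_of_tendsto_of_le_of_le tendsto_const_nhds hsum (fun _ => zero_le)
    fun p => ?_
  have hGS : G ⊆ ⋃ ξ, S ξ := fun x hx => by
    obtain ⟨ξ, hξ, H⟩ := hcov x hx
    exact mem_iUnion.2 ⟨⟨ξ, hξ⟩, hx, H⟩
  refine (lintegral_mono_set hGS).trans ((lintegral_iUnion_le _ _).trans_eq ?_)
  rw [tsum_fintype]

/-! ### Abstract spectral and variational arguments in Hilbert space -/

section Hilbert

variable {E X Y Z : Type*} [NormedAddCommGroup E] [InnerProductSpace ℝ E]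
  [NormedAddCommGroup X] [InnerProductSpace ℝ X] [NormedAddCommGroup Y] [InnerProductSpace ℝ Y]
  [NormedAddCommGroup Z] [InnerProductSpace ℝ Z]

/-- In the application L extracts the field, G its gradient, and the identity says that the norm is
the graph norm. Cauchy sequences can then be checked on the two components. -/
theorem CauchySeq.of_norm_sq_eq {L : E →L[ℝ] X} {G : E →L[ℝ] Y}
    (hn : ∀ v, ‖v‖ ^ 2 = ‖L v‖ ^ 2 + ‖G v‖ ^ 2) {u : ℕ → E} (h1 : CauchySeq fun n => L (u n))
    (h2 : CauchySeq fun n => G (u n)) : CauchySeq u := by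
  rw [cauchySeq_iff_tendsto_dist_atTop_0] at h1 h2 ⊢
  refine squeeze_zero (fun _ => dist_nonneg) (fun p => ?_) (by simpa using h1.add h2)
  simp only [dist_eq_norm, ← map_sub]
  refine abs_le_of_sq_le_sq' ?_ (by positivity) |>.2
  rw [hn]
  nlinarith [norm_nonneg (L (u p.1 - u p.2)), norm_nonneg (G (u p.1 - u p.2))]

/-- Equivalence of the energy norm, augmented by a weaker injective term, with the full norm, under
a compactness assumption. -/
theorem exists_norm_le_of_compact [CompleteSpace E] {L : E →L[ℝ] X} {G : E →L[ℝ] Y} {T : E →L[ℝ] Z}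
    (hn : ∀ v, ‖v‖ ^ 2 = ‖L v‖ ^ 2 + ‖G v‖ ^ 2) (hT : ∀ v, T v = 0 → L v = 0)
    (V : Submodule ℝ E)
    (hcpt : ∀ (u : ℕ → E) (M : ℝ), (∀ n, u n ∈ V) → (∀ n, ‖u n‖ ≤ M) →
      ∃ φ : ℕ → ℕ, StrictMono φ ∧ CauchySeq fun n => L (u (φ n))) :
    ∃ C : ℝ, ∀ v ∈ V, ‖v‖ ≤ C * (‖G v‖ + ‖T v‖) := by
  -- Normalized counterexamples have G and T parts tending to 0. By compactness a subsequence
  -- converges to a unit vector killed by G and T, hence by L, contradicting the norm identity. T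
  -- need only be injective on the L part; no lower bound is required.
  by_contra! hcon
  choose v hvV hv using fun n : ℕ => hcon n
  have hpos : ∀ n, 0 < ‖v n‖ := fun n => lt_of_le_of_lt (by positivity) (hv n)
  set u : ℕ → E := fun n => ‖v n‖⁻¹ • v n with hu
  have hu1 : ∀ n, ‖u n‖ = 1 := fun n => by
    simp [hu, norm_smul, (hpos n).ne']
  have huV : ∀ n, u n ∈ V := fun n => V.smul_mem _ (hvV n)
  have hbd : ∀ n : ℕ, n * (‖G (u n)‖ + ‖T (u n)‖) ≤ 1 := fun n => by
    simp only [hu, map_smul, norm_smul, norm_inv, norm_norm]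
    have := (hv n).le
    calc n * (‖v n‖⁻¹ * ‖G (v n)‖ + ‖v n‖⁻¹ * ‖T (v n)‖)
        = ‖v n‖⁻¹ * (n * (‖G (v n)‖ + ‖T (v n)‖)) := by ring
      _ ≤ ‖v n‖⁻¹ * ‖v n‖ := by gcongr
      _ = 1 := inv_mul_cancel₀ (hpos n).ne'
  have hz : Tendsto (fun n : ℕ => ‖G (u n)‖ + ‖T (u n)‖) atTop (𝓝 0) := by
    refine squeeze_zero' (Eventually.of_forall fun n => by positivity) ?_
      tendsto_one_div_atTop_nhds_zero_nat
    filter_upwards [eventually_gt_atTop 0] with n hn0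
    rw [le_div_iff₀ (by exact_mod_cast hn0), mul_comm]
    exact hbd n
  obtain ⟨φ, hφ, hL⟩ := hcpt u 1 huV fun n => (hu1 n).le
  have hzφ := hz.comp hφ.tendsto_atTop
  have hG0 : Tendsto (fun n => G (u (φ n))) atTop (𝓝 0) :=
    squeeze_zero_norm (fun n => le_add_of_nonneg_right (norm_nonneg _)) hzφ
  have hT0 : Tendsto (fun n => T (u (φ n))) atTop (𝓝 0) :=
    squeeze_zero_norm (fun n => le_add_of_nonneg_left (norm_nonneg _)) hzφ
  obtain ⟨w, hw⟩ := cauchySeq_tendsto_of_complete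
    (CauchySeq.of_norm_sq_eq hn hL hG0.cauchySeq)
  have hw1 : ‖w‖ = 1 := tendsto_nhds_unique hw.norm (by simp [hu1])
  have hGw : G w = 0 := tendsto_nhds_unique ((G.continuous.tendsto w).comp hw) hG0
  have hTw : T w = 0 := tendsto_nhds_unique ((T.continuous.tendsto w).comp hw) hT0
  have := hn w
  rw [hGw, hT w hTw, hw1] at this
  simp at this

/-- Existence of a minimizer of the Rayleigh quotient. -/
theorem exists_rayleigh_minimizer [CompleteSpace E] {L : E →L[ℝ] X} {G : E →L[ℝ] Y} {T : E →L[ℝ] Z} {c : ℝ}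
    (hn : ∀ v, ‖v‖ ^ 2 = ‖L v‖ ^ 2 + ‖G v‖ ^ 2) (hT : ∀ v, T v = 0 → L v = 0)
    (hTL : ∀ v, ‖T v‖ ≤ c * ‖L v‖)
    (V : Submodule ℝ E) (hV : IsClosed (V : Set E))
    (hcpt : ∀ (u : ℕ → E) (M : ℝ), (∀ n, u n ∈ V) → (∀ n, ‖u n‖ ≤ M) →
      ∃ φ : ℕ → ℕ, StrictMono φ ∧ CauchySeq fun n => L (u (φ n)))
    {e : E} (he : e ∈ V) (hTe : T e ≠ 0) :
    ∃ v ∈ V, ‖T v‖ = 1 ∧ ∀ w ∈ V, ‖G v‖ ^ 2 * ‖T w‖ ^ 2 ≤ ‖G w‖ ^ 2 := by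
  obtain ⟨C, hC⟩ := exists_norm_le_of_compact hn hT V hcpt
  set A : Set ℝ := {a | ∃ w ∈ V, ‖T w‖ = 1 ∧ ‖G w‖ ^ 2 = a} with hA
  have hnorm : ∀ w ∈ V, T w ≠ 0 → ‖G (‖T w‖⁻¹ • w)‖ ^ 2 ∈ A := fun w hw h0 =>
    ⟨‖T w‖⁻¹ • w, V.smul_mem _ hw, by simp [norm_smul, h0], rfl⟩
  have hbdd : BddBelow A := ⟨0, by rintro a ⟨w, -, -, rfl⟩; positivity⟩
  set m := sInf A with hm
  have hmin : ∀ w ∈ V, m * ‖T w‖ ^ 2 ≤ ‖G w‖ ^ 2 := fun w hw => by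
    by_cases h0 : T w = 0
    · simp [h0]
    · have h1 := csInf_le hbdd (hnorm w hw h0)
      rw [map_smul, norm_smul, norm_inv, norm_norm, mul_pow, inv_pow, inv_mul_eq_div,
        le_div_iff₀ (by positivity)] at h1
      exact h1
  obtain ⟨a, -, ha, haA⟩ := exists_seq_tendsto_sInf ⟨_, hnorm e he hTe⟩ hbdd
  choose u huV huT hua using haA
  obtain ⟨B, hB⟩ := ha.bddAbove_range
  have hub : ∀ n, ‖u n‖ ≤ |C| * (√B + 1) := fun n => by
    refine (hC _ (huV n)).trans ?_
    rw [huT]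
    gcongr
    · exact le_abs_self C
    · exact Real.le_sqrt_of_sq_le ((hua n).trans_le (hB (mem_range_self n)))
  obtain ⟨φ, hφ, hL⟩ := hcpt u _ huV hub
  have haφ : Tendsto (fun n => a (φ n)) atTop (𝓝 m) := ha.comp hφ.tendsto_atTop
  have hTd : Tendsto (fun p : ℕ × ℕ => ‖T (u (φ p.1) - u (φ p.2))‖) atTop (𝓝 0) := by
    rw [cauchySeq_iff_tendsto_dist_atTop_0] at hL
    refine squeeze_zero (fun _ => norm_nonneg _) (fun p => hTL _) ?_
    simpa [dist_eq_norm] using hL.const_mul c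
  -- Strong convergence of a minimizing sequence comes from the parallelogram law: the sum of two
  -- normalized vectors has Rayleigh quotient at least m, so ‖G(u - u')‖² ≤ 2(a - m) + 2(a' - m) + m
  -- ‖T(u - u')‖², and the T differences tend to 0 by compactness.
  have hGc : CauchySeq fun n => G (u (φ n)) := by
    rw [cauchySeq_iff_tendsto_dist_atTop_0]
    have h1 : Tendsto (fun p : ℕ × ℕ => √(2 * (a (φ p.1) - m) + 2 * (a (φ p.2) - m) +
        m * ‖T (u (φ p.1) - u (φ p.2))‖ ^ 2)) atTop (𝓝 0) := by
      have h2 := (((haφ.comp tendsto_fst).sub_const m).const_mul 2).add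
        (((haφ.comp tendsto_snd).sub_const m).const_mul 2)
      rw [prod_atTop_atTop_eq] at h2
      have h3 := (h2.add ((hTd.pow 2).const_mul m)).sqrt
      simpa using h3
    refine squeeze_zero (fun _ => dist_nonneg) (fun p => ?_) h1
    refine Real.le_sqrt_of_sq_le ?_
    rw [dist_eq_norm]
    have p1 := parallelogram_law_with_norm ℝ (G (u (φ p.1))) (G (u (φ p.2)))
    have p2 := parallelogram_law_with_norm ℝ (T (u (φ p.1))) (T (u (φ p.2)))
    have h4 := hmin _ (V.add_mem (huV (φ p.1)) (huV (φ p.2)))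
    rw [map_add, map_add] at h4
    rw [map_sub]
    rw [huT, huT] at p2
    have e1 := hua (φ p.1)
    have e2 := hua (φ p.2)
    have e3 : ‖T (u (φ p.1)) + T (u (φ p.2))‖ ^ 2 = 4 - ‖T (u (φ p.1)) - T (u (φ p.2))‖ ^ 2 := by
      linarith
    rw [e3] at h4
    linarith
  obtain ⟨v, hv⟩ := cauchySeq_tendsto_of_complete (CauchySeq.of_norm_sq_eq hn hL hGc)
  refine ⟨v, hV.mem_of_tendsto hv (Eventually.of_forall fun n => huV _), ?_, ?_⟩
  · exact tendsto_nhds_unique ((T.continuous.tendsto v).comp hv).norm (by simp [huT])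
  · have : ‖G v‖ ^ 2 = m := tendsto_nhds_unique
      (((G.continuous.tendsto v).comp hv).norm.pow 2) (by simpa [hua] using haφ)
    rwa [this]

/-- Perturbing v to v + t w gives a quadratic polynomial in t that is nonnegative and has no
constant term, so its linear coefficient vanishes. -/
theorem rayleigh_minimizer_euler {G : E →L[ℝ] Y} {T : E →L[ℝ] Z} (V : Submodule ℝ E)
    {v : E} (hv : v ∈ V) (hTv : ‖T v‖ = 1)
    (hmin : ∀ w ∈ V, ‖G v‖ ^ 2 * ‖T w‖ ^ 2 ≤ ‖G w‖ ^ 2) (w : E) (hw : w ∈ V) :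
    inner ℝ (G v) (G w) = ‖G v‖ ^ 2 * inner ℝ (T v) (T w) := by
  have h : ∀ t : ℝ, 0 ≤ (‖G w‖ ^ 2 - ‖G v‖ ^ 2 * ‖T w‖ ^ 2) * (t * t) +
      2 * (inner ℝ (G v) (G w) - ‖G v‖ ^ 2 * inner ℝ (T v) (T w)) * t + 0 := by
    intro t
    have h1 := hmin _ (V.add_mem hv (V.smul_mem t hw))
    simp only [map_add, map_smul, norm_add_sq_real, inner_smul_right, norm_smul, hTv, mul_pow,
      Real.norm_eq_abs, sq_abs] at h1
    nlinarith
  have := discrim_le_zero h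
  rw [discrim] at this
  nlinarith [sq_nonneg (inner ℝ (G v) (G w) - ‖G v‖ ^ 2 * inner ℝ (T v) (T w))]

/-- If `(φ, lam)` lists all eigenpairs of `⟨G φ, G v⟩ = lam ⟨T φ, T v⟩` in ascending order, then
the Rayleigh quotient is at least `lam l` on the complement of the first `l` eigenvectors. -/
theorem eigenvalue_mul_le [CompleteSpace E] {L : E →L[ℝ] X} {G : E →L[ℝ] Y} {T : E →L[ℝ] Z} {c : ℝ}
    (hn : ∀ v, ‖v‖ ^ 2 = ‖L v‖ ^ 2 + ‖G v‖ ^ 2) (hT : ∀ v, T v = 0 → L v = 0)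
    (hTL : ∀ v, ‖T v‖ ≤ c * ‖L v‖)
    (V : Submodule ℝ E) (hV : IsClosed (V : Set E))
    (hcpt : ∀ (u : ℕ → E) (M : ℝ), (∀ n, u n ∈ V) → (∀ n, ‖u n‖ ≤ M) →
      ∃ φ : ℕ → ℕ, StrictMono φ ∧ CauchySeq fun n => L (u (φ n)))
    {φ : ℕ → E} {lam : ℕ → ℝ} (hφV : ∀ j, φ j ∈ V)
    (heig : ∀ j, ∀ v ∈ V, inner ℝ (G (φ j)) (G v) = lam j * inner ℝ (T (φ j)) (T v))
    (horth : ∀ j k, inner ℝ (T (φ j)) (T (φ k)) = if j = k then (1 : ℝ) else 0)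
    (hmono : Monotone lam)
    (hexh : ∀ ψ ∈ V, ∀ m, (∀ v ∈ V, inner ℝ (G ψ) (G v) = m * inner ℝ (T ψ) (T v)) →
      ψ ∈ Submodule.span ℝ (φ '' {j | lam j = m}))
    (l : ℕ) {e : E} (he : e ∈ V) (hel : ∀ j < l, inner ℝ (T e) (T (φ j)) = (0 : ℝ)) :
    lam l * ‖T e‖ ^ 2 ≤ ‖G e‖ ^ 2 := by
  by_cases hTe : T e = 0
  · simp [hTe]
  -- `W` is the T-orthogonal complement in `V` of the first l eigenvectors. The Rayleigh quotient is
  -- minimized there, and the claim becomes `lam l ≤ ‖G v‖ ^ 2` for the minimizer v.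
  let W : Submodule ℝ E := V ⊓ ⨅ j : Fin l, LinearMap.ker ((innerSL ℝ (T (φ j))).comp T).toLinearMap
  have hW : ∀ w, w ∈ W ↔ w ∈ V ∧ ∀ j < l, inner ℝ (T (φ j)) (T w) = (0 : ℝ) := fun w => by
    simp only [W, Submodule.mem_inf, Submodule.mem_iInf, LinearMap.mem_ker]
    exact and_congr_right fun _ => ⟨fun h j hj => h ⟨j, hj⟩, fun h j => h j j.2⟩
  have hWc : IsClosed (W : Set E) := by
    have : (W : Set E) = (V : Set E) ∩ ⋂ j : Fin l, {w | inner ℝ (T (φ j)) (T w) = (0 : ℝ)} := by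
      ext w
      simp only [SetLike.mem_coe, hW, mem_inter_iff, mem_iInter, mem_ofPred_eq]
      exact and_congr_right fun _ => ⟨fun h j => h j j.2, fun h j hj => h ⟨j, hj⟩⟩
    rw [this]
    refine hV.inter (isClosed_iInter fun j => isClosed_eq ?_ continuous_const)
    exact continuous_const.inner T.continuous
  have heW : e ∈ W := (hW e).2 ⟨he, fun j hj => by rw [real_inner_comm]; exact hel j hj⟩
  obtain ⟨v, hv, hTv, hmin⟩ := exists_rayleigh_minimizer hn hT hTL W hWc
    (fun u M hu => hcpt u M fun n => ((hW _).1 (hu n)).1) heW hTe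
  refine le_trans ?_ (hmin e heW)
  gcongr
  by_contra! hlt
  have hvW := (hW v).1 hv
  have hortho' : ∀ j < l, inner ℝ (T v) (T (φ j)) = (0 : ℝ) := fun j hj => by
    rw [real_inner_comm]; exact hvW.2 j hj
  -- The Euler equation on `W` extends to `V`: removing the T-projection p onto the first l
  -- eigenvectors changes neither side, since v is orthogonal to each of them in both forms. Thus v
  -- is an eigenvector with eigenvalue ‖G v‖².
  have hEL : ∀ w ∈ V, inner ℝ (G v) (G w) = ‖G v‖ ^ 2 * inner ℝ (T v) (T w) := by
    intro w hw
    set p := ∑ j ∈ Finset.range l, inner ℝ (T (φ j)) (T w) • φ j with hp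
    have hpV : p ∈ V := V.sum_mem fun j _ => V.smul_mem _ (hφV j)
    have hwp : w - p ∈ W := by
      refine (hW _).2 ⟨V.sub_mem hw hpV, fun j hj => ?_⟩
      simp [hp, inner_sub_right, inner_sum, inner_smul_right, horth, hj]
    have h1 := rayleigh_minimizer_euler W hv hTv hmin _ hwp
    have h2 : inner ℝ (G v) (G p) = (0 : ℝ) := by
      simp only [hp, map_sum, map_smul, inner_sum, inner_smul_right]
      refine Finset.sum_eq_zero fun j hj => ?_
      rw [real_inner_comm (G (φ j)), heig j v hvW.1, hvW.2 j (Finset.mem_range.1 hj)]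
      simp
    have h3 : inner ℝ (T v) (T p) = (0 : ℝ) := by
      simp only [hp, map_sum, map_smul, inner_sum, inner_smul_right]
      refine Finset.sum_eq_zero fun j hj => ?_
      rw [hortho' j (Finset.mem_range.1 hj)]
      simp
    rw [map_sub, map_sub, inner_sub_right, inner_sub_right, h2, h3] at h1
    simpa using h1
  -- If ‖G v‖² < lam l, every listed eigenvector for this eigenvalue has index below l by
  -- monotonicity. So v lies in a span to which it is T-orthogonal, against ‖T v‖ = 1.
  have hspan := hexh v hvW.1 _ hEL
  have hsub : ∀ w ∈ Submodule.span ℝ (φ '' {j | lam j = ‖G v‖ ^ 2}),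
      inner ℝ (T v) (T w) = (0 : ℝ) := by
    intro w hw
    induction hw using Submodule.span_induction with
    | mem x hx =>
      obtain ⟨j, hj, rfl⟩ := hx
      refine hortho' j ?_
      by_contra! hlj
      have := hmono hlj
      rw [hj] at this
      linarith
    | zero => simp
    | add x y _ _ hx hy => rw [map_add, inner_add_right, hx, hy, add_zero]
    | smul a x _ hx => rw [map_smul, inner_smul_right, hx, mul_zero]
  have := hsub v hspan
  rw [real_inner_self_eq_norm_sq, hTv] at this
  norm_num at this

/-- Minimizers of `‖G ψ‖² + ‖P ψ - e_k‖²` over a closed subspace `V` determine the complement of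
the kernel of `P`: a vector whose image under `G` is orthogonal to all of them lies in `ker P`. -/
theorem apply_eq_zero_of_orthogonal_minimizers {ι : Type*} [Fintype ι] [DecidableEq ι]
    [CompleteSpace E] [CompleteSpace Y]
    (G : E →L[ℝ] Y) (P : E →L[ℝ] EuclideanSpace ℝ ι) (V : Submodule ℝ E)
    (hV : IsClosed (V : Set E)) {C : ℝ} (hC : ∀ v ∈ V, ‖v‖ ≤ C * ‖G v‖) {e : E} (he : e ∈ V)
    (horth : ∀ k, ∀ ψ ∈ V,
      IsMinOn (fun ψ => ‖G ψ‖ ^ 2 + ‖P ψ - EuclideanSpace.single k (1 : ℝ)‖ ^ 2) V ψ →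
      inner ℝ (G ψ) (G e) = (0 : ℝ)) : P e = 0 := by
  have : CompleteSpace V := hV.completeSpace_coe
  -- The pair (G, P) maps `V` onto a closed subspace of the product, closed because G alone is
  -- bounded below on `V`. Minimizing the functional is projecting (0, e_k) onto that subspace,
  -- which gives both existence and the normal equation.
  let A : V →L[ℝ] WithLp 2 (Y × EuclideanSpace ℝ ι) :=
    (WithLp.prodContinuousLinearEquiv 2 ℝ Y (EuclideanSpace ℝ ι)).symm.toContinuousLinearMap.comp
      ((G.prod P).comp V.subtypeL)
  have hAf : ∀ v : V, (A v).fst = G v := fun v => rfl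
  have hAs : ∀ v : V, (A v).snd = P v := fun v => rfl
  have hanti : AntilipschitzWith (Real.toNNReal C) A := by
    refine ContinuousLinearMap.antilipschitz_of_bound A fun v => ?_
    calc ‖v‖ ≤ C * ‖G v‖ := hC v v.2
      _ ≤ Real.toNNReal C * ‖A v‖ := by
        refine mul_le_mul (Real.le_coe_toNNReal C) ?_ (norm_nonneg _) NNReal.zero_le_coe
        refine abs_le_of_sq_le_sq' ?_ (by positivity) |>.2
        rw [WithLp.prod_norm_sq_eq_of_L2, hAf]
        nlinarith [sq_nonneg ‖(A v).snd‖]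
  have hcl : IsComplete (LinearMap.range A.toLinearMap : Set (WithLp 2 (Y × EuclideanSpace ℝ ι))) := by
    have := hanti.isClosed_range A.uniformContinuous
    exact this.isComplete
  have hex : ∀ k : ι, ∃ ψ ∈ V, inner ℝ (G ψ) (G e) = (0 : ℝ) ∧ ∀ v ∈ V,
      inner ℝ (G ψ) (G v) = (inner ℝ (EuclideanSpace.single k (1 : ℝ) - P ψ) (P v) : ℝ) := by
    intro k
    set b : WithLp 2 (Y × EuclideanSpace ℝ ι) :=
      WithLp.toLp 2 (0, EuclideanSpace.single k (1 : ℝ)) with hb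
    obtain ⟨_, ⟨ψ, rfl⟩, hψ⟩ := Submodule.exists_norm_eq_iInf_of_complete_subspace
      (LinearMap.range A.toLinearMap) hcl b
    refine ⟨ψ, ψ.2, horth k ψ ψ.2 ?_, fun v hv => ?_⟩
    · intro w hw
      have h1 : ‖b - A ψ‖ ≤ ‖b - A ⟨w, hw⟩‖ := by
        refine hψ.trans_le ?_
        exact ciInf_le (f := fun x : LinearMap.range A.toLinearMap =>
          ‖b - (x : WithLp 2 (Y × EuclideanSpace ℝ ι))‖)
          ⟨0, by rintro _ ⟨x, rfl⟩; exact norm_nonneg _⟩ ⟨A ⟨w, hw⟩, ⟨⟨w, hw⟩, rfl⟩⟩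
      have h2 := pow_le_pow_left₀ (norm_nonneg _) h1 2
      rw [WithLp.prod_norm_sq_eq_of_L2, WithLp.prod_norm_sq_eq_of_L2] at h2
      simp only [WithLp.sub_fst, WithLp.sub_snd, hAf, hAs, hb, WithLp.toLp_fst, WithLp.toLp_snd,
        zero_sub, norm_neg] at h2
      simpa only [mem_ofPred_eq, norm_sub_rev] using h2
    · have h3 := (Submodule.norm_eq_iInf_iff_real_inner_eq_zero
        (LinearMap.range A.toLinearMap) ⟨ψ, rfl⟩).1 hψ (A ⟨v, hv⟩) ⟨⟨v, hv⟩, rfl⟩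
      have h4 : inner ℝ (b - A ψ) (A ⟨v, hv⟩) = inner ℝ (b - A ψ).fst (A ⟨v, hv⟩).fst +
          (inner ℝ (b - A ψ).snd (A ⟨v, hv⟩).snd : ℝ) := WithLp.prod_inner_apply _ _
      rw [ContinuousLinearMap.coe_coe, h4] at h3
      simp only [WithLp.sub_fst, WithLp.sub_snd, hAf, hAs, hb, WithLp.toLp_fst, WithLp.toLp_snd,
        zero_sub, inner_neg_left] at h3
      linarith
  choose ψ hψV hψe hψ using hex
  set w := P e with hw
  -- Superposition with weights w = P e gives ⟨G Ψ, G v⟩ = ⟨w - P Ψ, P v⟩. Taking v = e gives ⟨w - P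
  -- Ψ, w⟩ = 0, taking v = Ψ gives ‖G Ψ‖² = ⟨w - P Ψ, P Ψ⟩; together ‖w - P Ψ‖² + ‖G Ψ‖² = 0.
  set Ψ := ∑ k, w k • ψ k with hΨ
  have hΨV : Ψ ∈ V := V.sum_mem fun k _ => V.smul_mem _ (hψV k)
  have hwsum : w = ∑ k, w k • EuclideanSpace.single k (1 : ℝ) := by
    ext i
    simp [Finset.sum_apply, Pi.single_apply]
  have hΨe : inner ℝ (G Ψ) (G e) = (0 : ℝ) := by
    simp [hΨ, sum_inner, inner_smul_left, hψe]
  have hΨv : ∀ v ∈ V, inner ℝ (G Ψ) (G v) = (inner ℝ (w - P Ψ) (P v) : ℝ) := fun v hv => by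
    have : w - P Ψ = ∑ k, w k • (EuclideanSpace.single k (1 : ℝ) - P (ψ k)) := by
      conv_lhs => rw [hwsum]
      simp [hΨ, smul_sub, Finset.sum_sub_distrib]
    rw [this]
    simp [hΨ, sum_inner, inner_smul_left, hψ _ v hv]
  have h1 := hΨv e he
  rw [hΨe] at h1
  have h2 := hΨv Ψ hΨV
  rw [real_inner_self_eq_norm_sq] at h2
  have h3 : ‖w - P Ψ‖ ^ 2 + ‖G Ψ‖ ^ 2 = 0 := by
    rw [h2, ← real_inner_self_eq_norm_sq, inner_sub_right, ← h1]
    ring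
  have h4 : G Ψ = 0 := by
    rw [← norm_eq_zero]
    nlinarith [sq_nonneg ‖w - P Ψ‖, sq_nonneg ‖G Ψ‖]
  have h5 : w - P Ψ = 0 := by
    rw [← norm_eq_zero]
    nlinarith [sq_nonneg ‖w - P Ψ‖, sq_nonneg ‖G Ψ‖]
  have h6 : Ψ = 0 := by
    have := hC Ψ hΨV
    rw [h4] at this
    simpa using this
  rw [h6, map_zero, sub_zero] at h5
  exact h5

end Hilbert

/-! ### Square norms in L² -/

section Lebesgue

variable {α F : Type*} [MeasurableSpace α] {μ : Measure α} [NormedAddCommGroup F]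

theorem enorm_sq_eq_lintegral (f : Lp F 2 μ) : ‖f‖ₑ ^ 2 = ∫⁻ x, ‖f x‖ₑ ^ 2 ∂μ := by
  rw [Lp.enorm_def, eLpNorm_eq_lintegral_rpow_enorm_toReal (by norm_num) (by norm_num),
    ← ENNReal.rpow_mul_natCast]
  norm_num

theorem norm_sq_eq_integral [InnerProductSpace ℝ F] (f : Lp F 2 μ) :
    ‖f‖ ^ 2 = ∫ x, ‖f x‖ ^ 2 ∂μ := by
  rw [← real_inner_self_eq_norm_sq, L2.inner_def]
  simp

theorem integrable_norm_sq (f : Lp F 2 μ) : Integrable (fun x => ‖f x‖ ^ 2) μ :=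
  (memLp_two_iff_integrable_sq_norm (Lp.aestronglyMeasurable f)).1 (Lp.memLp f)

end Lebesgue

/-! ### Fields in H¹₀: Jacobian, divergence, Poincaré's inequality -/

variable {d : ℕ}

theorem aForm_eq_inner {μ : Measure (Vec d)} (U V : SobPair d μ) :
    aForm U V = inner ℝ U.snd V.snd := (L2.inner_def _ _).symm

theorem energyNorm_eq_norm {μ : Measure (Vec d)} (U : SobPair d μ) : energyNorm U = ‖U.snd‖ := by
  rw [energyNorm, aForm_eq_inner, real_inner_self_eq_norm_sq, Real.sqrt_sq (norm_nonneg _)]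

theorem norm_sq_eq_add {μ : Measure (Vec d)} (U : SobPair d μ) :
    ‖U‖ ^ 2 = ‖U.fst‖ ^ 2 + ‖U.snd‖ ^ 2 := WithLp.prod_norm_sq_eq_of_L2 U

theorem jacobian_apply (v : Vec d → Vec d) (x : Vec d) (i j : Fin d) :
    jacobian v x (i, j) = fderiv ℝ v x (EuclideanSpace.single j (1 : ℝ)) i := rfl

/-- The operator norm is dominated by the Frobenius norm: Cauchy–Schwarz row by row. -/
theorem norm_fderiv_le_norm_jacobian (v : Vec d → Vec d) (x : Vec d) :
    ‖fderiv ℝ v x‖ ≤ ‖jacobian v x‖ := by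
  refine ContinuousLinearMap.opNorm_le_bound _ (norm_nonneg _) fun z => ?_
  refine abs_le_of_sq_le_sq' ?_ (by positivity) |>.2
  rw [mul_pow, EuclideanSpace.norm_sq_eq, EuclideanSpace.norm_sq_eq, EuclideanSpace.norm_sq_eq,
    Fintype.sum_prod_type, Finset.sum_mul]
  refine Finset.sum_le_sum fun i _ => ?_
  have hz : fderiv ℝ v x z i = ∑ j, jacobian v x (i, j) * z j := by
    conv_lhs => rw [← (EuclideanSpace.basisFun (Fin d) ℝ).sum_repr z]
    simp [map_sum, jacobian_apply, mul_comm]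
  simp only [Real.norm_eq_abs, sq_abs]
  rw [hz]
  exact Finset.sum_mul_sq_le_sq_mul_sq _ _ _

theorem continuous_jacobian {v : Vec d → Vec d} (hv : ContDiff ℝ 1 v) :
    Continuous (jacobian v) := by
  refine (PiLp.continuous_toLp 2 (fun _ : Fin d × Fin d => ℝ)).comp (continuous_pi fun ij => ?_)
  have h1 : Continuous fun x => fderiv ℝ v x (EuclideanSpace.single ij.2 (1 : ℝ)) :=
    (hv.continuous_fderiv (by norm_num)).clm_apply continuous_const
  exact (EuclideanSpace.proj (𝕜 := ℝ) ij.1).continuous.comp h1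

theorem HasCompactSupport.jacobian {v : Vec d → Vec d} (hv : HasCompactSupport v) :
    HasCompactSupport (jacobian v) := by
  refine (hv.fderiv (𝕜 := ℝ)).mono fun x hx => ?_
  contrapose! hx
  simp only [Function.mem_support, not_not] at hx ⊢
  ext ij
  simp [StokesCEM.jacobian, hx]

theorem tsupport_jacobian_subset (v : Vec d → Vec d) : tsupport (jacobian v) ⊆ tsupport v := by
  refine (closure_mono fun x hx => ?_).trans (tsupport_fderiv_subset (𝕜 := ℝ) (f := v))
  contrapose! hx
  simp only [Function.mem_support, not_not] at hx ⊢
  ext ij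
  simp [jacobian, hx]

theorem IsTestField.contDiff_one {D : Set (Vec d)} {v : Vec d → Vec d} (hv : IsTestField D v) :
    ContDiff ℝ 1 v := hv.1.of_le (by norm_num)

theorem exists_isTestField_of_mem_span {D : Set (Vec d)}
    {U : SobPair d (volume.restrict D)}
    (hU : U ∈ Submodule.span ℝ {U : SobPair d (volume.restrict D) | ∃ v : Vec d → Vec d,
      IsTestField D v ∧ (U.fst : Vec d → Vec d) =ᵐ[volume.restrict D] v ∧
      (U.snd : Vec d → Mat d) =ᵐ[volume.restrict D] jacobian v}) :
    ∃ v : Vec d → Vec d, IsTestField D v ∧ (U.fst : Vec d → Vec d) =ᵐ[volume.restrict D] v ∧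
      (U.snd : Vec d → Mat d) =ᵐ[volume.restrict D] jacobian v := by
  induction hU using Submodule.span_induction with
  | mem U hU => exact hU
  | zero =>
    refine ⟨0, ⟨contDiff_const, HasCompactSupport.zero, by simp [tsupport]⟩, ?_, ?_⟩
    · exact Lp.coeFn_zero _ _ _
    · refine (Lp.coeFn_zero _ _ _).trans (Eventually.of_forall fun x => ?_)
      ext ij
      simp [jacobian]
  | add U V _ _ hU hV =>
    obtain ⟨u, hu, hu1, hu2⟩ := hU
    obtain ⟨v, hv, hv1, hv2⟩ := hV
    refine ⟨u + v, ⟨hu.1.add hv.1, hu.2.1.add hv.2.1, ?_⟩, ?_, ?_⟩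
    · exact (tsupport_add u v).trans (union_subset hu.2.2 hv.2.2)
    · exact (Lp.coeFn_add _ _).trans (hu1.add hv1)
    · refine (Lp.coeFn_add _ _).trans ((hu2.add hv2).trans (Eventually.of_forall fun x => ?_))
      ext ij
      simp only [jacobian, Pi.add_apply, PiLp.add_apply]
      rw [fderiv_add (hu.contDiff_one.differentiable (by norm_num)).differentiableAt
        (hv.contDiff_one.differentiable (by norm_num)).differentiableAt]
      simp
  | smul c U _ hU =>
    obtain ⟨u, hu, hu1, hu2⟩ := hU
    refine ⟨c • u, ⟨hu.1.const_smul c, hu.2.1.smul_left (f := fun _ => c), ?_⟩, ?_, ?_⟩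
    · exact (closure_mono (Function.support_const_smul_subset c u)).trans hu.2.2
    · exact (Lp.coeFn_smul _ _).trans (hu1.const_smul c)
    · refine (Lp.coeFn_smul _ _).trans ((hu2.const_smul c).trans (Eventually.of_forall fun x => ?_))
      ext ij
      simp only [jacobian, Pi.smul_apply, PiLp.smul_apply]
      rw [fderiv_const_smul (hu.contDiff_one.differentiable (by norm_num)).differentiableAt]
      simp

/-- To prove a closed property for all elements of `H¹₀`, it suffices to prove it for test
fields. -/
theorem V0_induction {D : Set (Vec d)} {p : SobPair d (volume.restrict D) → Prop}
    (hp : IsClosed {U | p U})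
    (h : ∀ (U : SobPair d (volume.restrict D)) (v : Vec d → Vec d), IsTestField D v →
      (U.fst : Vec d → Vec d) =ᵐ[volume.restrict D] v →
      (U.snd : Vec d → Mat d) =ᵐ[volume.restrict D] jacobian v → p U)
    {U : SobPair d (volume.restrict D)} (hU : U ∈ V0 D) : p U := by
  refine closure_minimal (fun W hW => ?_) hp hU
  obtain ⟨v, hv, h1, h2⟩ := exists_isTestField_of_mem_span hW
  exact h W v hv h1 h2

/-- The trace of a matrix. -/
noncomputable def traceL (d : ℕ) : Mat d →L[ℝ] ℝ := ∑ i : Fin d, EuclideanSpace.proj (i, i)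

theorem traceL_apply (A : Mat d) : traceL d A = ∑ i, A (i, i) := by
  simp [traceL]

/-- The divergence as a bounded operator into `L²`. -/
noncomputable def divL (μ : Measure (Vec d)) : SobPair d μ →L[ℝ] Lp ℝ 2 μ :=
  ((traceL d).compLpL 2 μ).comp (WithLp.sndL 2 ℝ (Lp (Vec d) 2 μ) (Lp (Mat d) 2 μ))

theorem coeFn_divL {μ : Measure (Vec d)} (U : SobPair d μ) : divL μ U =ᵐ[μ] div U := by
  refine ((traceL d).coeFn_compLpL U.snd).trans (Eventually.of_forall fun x => ?_)
  exact traceL_apply _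

theorem bForm_eq_inner {μ : Measure (Vec d)} (U : SobPair d μ) (q : Lp ℝ 2 μ) :
    bForm U q = inner ℝ (divL μ U) q := by
  rw [L2.inner_def]
  refine integral_congr_ae ?_
  filter_upwards [coeFn_divL U] with x hx
  rw [hx]
  simp

theorem ae_div_eq_zero_iff {μ : Measure (Vec d)} (U : SobPair d μ) :
    (∀ᵐ x ∂μ, div U x = 0) ↔ divL μ U = 0 := by
  rw [Lp.eq_zero_iff_ae_eq_zero]
  constructor
  · intro h
    filter_upwards [h, coeFn_divL U] with x h1 h2
    rw [h2, h1]; rfl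
  · intro h
    filter_upwards [h, coeFn_divL U] with x h1 h2
    rw [← h2, h1]; rfl

/-- The divergence-free fields as a subspace. -/
noncomputable def V0divSubmodule (D : Set (Vec d)) : Submodule ℝ (SobPair d (volume.restrict D)) :=
  V0 D ⊓ LinearMap.ker (divL (volume.restrict D)).toLinearMap

theorem mem_V0divSubmodule {D : Set (Vec d)} {U : SobPair d (volume.restrict D)} :
    U ∈ V0divSubmodule D ↔ U ∈ V0 D ∧ divL (volume.restrict D) U = 0 := Iff.rfl

theorem coe_V0divSubmodule (D : Set (Vec d)) : (V0divSubmodule D : Set _) = V0div D := by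
  ext U
  exact and_congr_right fun _ => (ae_div_eq_zero_iff U).symm

theorem isClosed_V0 (D : Set (Vec d)) : IsClosed (V0 D : Set (SobPair d (volume.restrict D))) :=
  Submodule.isClosed_topologicalClosure _

theorem isClosed_V0divSubmodule (D : Set (Vec d)) :
    IsClosed (V0divSubmodule D : Set (SobPair d (volume.restrict D))) :=
  (isClosed_V0 D).inter (divL (volume.restrict D)).isClosed_ker

theorem IsTestField.setIntegral_eq {D : Set (Vec d)} {v : Vec d → Vec d} (hv : IsTestField D v)
    {g : Vec d → ℝ} (hg : ∀ x, x ∉ tsupport v → g x = 0) :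
    ∫ x in D, g x = ∫ x, g x :=
  setIntegral_eq_integral_of_forall_compl_eq_zero fun x hx => hg x fun h => hx (hv.2.2 h)

/-- Integration by parts against the constant function 1. -/
theorem IsTestField.integral_fderiv_eq_zero {D : Set (Vec d)} {v : Vec d → Vec d}
    (hv : IsTestField D v) (e : Vec d) (i : Fin d) : ∫ x, fderiv ℝ v x e i = 0 := by
  have hd := hv.contDiff_one.differentiable (by norm_num)
  have hc : Continuous fun x => fderiv ℝ v x e :=
    (hv.contDiff_one.continuous_fderiv (by norm_num)).clm_apply continuous_const
  have hi : Integrable fun x => fderiv ℝ v x e := by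
    refine hc.integrable_of_hasCompactSupport ?_
    exact (hv.2.1.fderiv (𝕜 := ℝ)).mono fun x hx => by
      contrapose! hx
      simp only [Function.mem_support, not_not] at hx ⊢
      simp [hx]
  have h := integral_smul_fderiv_eq_neg_fderiv_smul_of_integrable (μ := (volume : Measure (Vec d)))
    (f := fun _ : Vec d => (1 : ℝ)) (g := v) (v := e) (by simp) (by simpa using hi)
    (by simpa using hv.1.continuous.integrable_of_hasCompactSupport hv.2.1)
    (fun x _ => differentiableAt_const _) (fun x _ => hd.differentiableAt)
  simp only [one_smul, fderiv_fun_const, Pi.zero_apply, zero_apply, zero_smul,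
    integral_zero, neg_zero] at h
  have h2 := (EuclideanSpace.proj (𝕜 := ℝ) i).integral_comp_comm hi
  rw [h, map_zero] at h2
  exact h2

/-- On a set of finite measure the integral is a continuous functional, the pairing with the
constant 1, so the case of test fields suffices. The result makes ∇·u itself an admissible zero-mean
pressure test function. -/
theorem integral_divL_eq_zero {D : Set (Vec d)} (hD : volume D ≠ ⊤)
    {U : SobPair d (volume.restrict D)} (hU : U ∈ V0 D) :
    ∫ x, divL (volume.restrict D) U x ∂(volume.restrict D) = 0 := by
  have hf : volume.restrict D univ ≠ ⊤ := by simpa using hD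
  have hint : ∀ U : SobPair d (volume.restrict D),
      inner ℝ (indicatorConstLp 2 MeasurableSet.univ hf (1 : ℝ)) (divL (volume.restrict D) U) =
      ∫ x, divL (volume.restrict D) U x ∂(volume.restrict D) := fun U => by
    rw [L2.inner_indicatorConstLp_one, Measure.restrict_univ]
  rw [← hint]
  refine V0_induction (p := fun U => inner ℝ (indicatorConstLp 2 MeasurableSet.univ hf (1 : ℝ))
    (divL (volume.restrict D) U) = 0) (isClosed_eq (by fun_prop) continuous_const) ?_ hU
  intro U v hv _ h2
  rw [hint]
  have h3 : ∫ x, divL (volume.restrict D) U x ∂(volume.restrict D) =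
      ∫ x in D, ∑ i, fderiv ℝ v x (EuclideanSpace.single i (1 : ℝ)) i := by
    refine integral_congr_ae ?_
    filter_upwards [coeFn_divL U, h2] with x hx hx2
    rw [hx, div]
    simp only [hx2, jacobian_apply]
  rw [h3, hv.setIntegral_eq, integral_finsetSum]
  · exact Finset.sum_eq_zero fun i _ => hv.integral_fderiv_eq_zero _ _
  · intro i _
    have hc : Continuous fun x => jacobian v x (i, i) :=
      (EuclideanSpace.proj (𝕜 := ℝ) (i, i)).continuous.comp (continuous_jacobian hv.contDiff_one)
    refine hc.integrable_of_hasCompactSupport ((HasCompactSupport.jacobian hv.2.1).mono fun x hx => ?_)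
    contrapose! hx
    simp only [Function.mem_support, not_not] at hx ⊢
    simp [hx]
  · intro x hx
    have := image_eq_zero_of_notMem_tsupport
      (fun h => hx (tsupport_fderiv_subset (𝕜 := ℝ) (f := v) h))
    simp [this]

/-- **Poincaré's inequality** for test fields. -/
theorem IsTestField.poincare {D : Set (Vec d)} {v : Vec d → Vec d} (hv : IsTestField D v)
    (i : Fin d) {R : ℝ} (hR : ∀ x ∈ D, ‖x‖ ≤ R) :
    ∫ x, ‖v x‖ ^ 2 ≤ 4 * R ^ 2 * ∫ x, ‖jacobian v x‖ ^ 2 := by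
  set e : Vec d := EuclideanSpace.single i (1 : ℝ) with he
  have hd := hv.contDiff_one.differentiable (by norm_num)
  have hcj := continuous_jacobian hv.contDiff_one
  have hcf : Continuous fun x => fderiv ℝ v x e :=
    (hv.contDiff_one.continuous_fderiv (by norm_num)).clm_apply continuous_const
  have hcv := hv.1.continuous
  have hint : ∀ g : Vec d → ℝ, Continuous g → (∀ x, v x = 0 → g x = 0) → Integrable g :=
    fun g hg h => hg.integrable_of_hasCompactSupport (hv.2.1.mono fun x hx h0 => hx (h x h0))
  have hdn : ∀ x, HasFDerivAt (fun x => ‖v x‖ ^ 2) (2 • (innerSL ℝ (v x)).comp (fderiv ℝ v x)) x :=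
    fun x => hd.differentiableAt.hasFDerivAt.norm_sq
  have hfd : ∀ x, fderiv ℝ (fun x => ‖v x‖ ^ 2) x e = 2 * inner ℝ (v x) (fderiv ℝ v x e) :=
    fun x => by rw [(hdn x).fderiv]; simp
  have hfp : ∀ x : Vec d, fderiv ℝ (fun x : Vec d => x i) x e = 1 := fun x => by
    have : HasFDerivAt (fun x : Vec d => x i) (EuclideanSpace.proj (𝕜 := ℝ) i : Vec d →L[ℝ] ℝ) x :=
      (EuclideanSpace.proj (𝕜 := ℝ) i : Vec d →L[ℝ] ℝ).hasFDerivAt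
    rw [this.fderiv]
    simp [he]
  have h := integral_smul_fderiv_eq_neg_fderiv_smul_of_integrable (μ := (volume : Measure (Vec d)))
    (f := fun x : Vec d => x i) (g := fun x => ‖v x‖ ^ 2) (v := e) ?_ ?_ ?_
    (fun x _ => (EuclideanSpace.proj (𝕜 := ℝ) i : Vec d →L[ℝ] ℝ).differentiableAt)
    (fun x _ => (hdn x).differentiableAt)
  rotate_left
  · simp only [hfp, one_smul]
    exact hint _ (by fun_prop) (by simp +contextual)
  · simp only [hfd, smul_eq_mul]
    exact hint _ (by fun_prop) (by simp +contextual)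
  · simp only [smul_eq_mul]
    exact hint _ (by fun_prop) (by simp +contextual)
  simp only [hfp, hfd, smul_eq_mul, one_mul] at h
  -- Integration by parts against the coordinate x_i gives ∫ |v|² = -∫ 2 x_i v · ∂_i v. Young's
  -- inequality 2R|v||∇v| ≤ |v|²/2 + 2R²|∇v|² lets half of the left side be absorbed, whence the
  -- factor 4R².
  have hpt : ∀ x, -(x i * (2 * inner ℝ (v x) (fderiv ℝ v x e))) ≤
      ‖v x‖ ^ 2 / 2 + 2 * R ^ 2 * ‖jacobian v x‖ ^ 2 := by
    intro x
    by_cases hx : x ∈ tsupport v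
    · have hxR := hR x (hv.2.2 hx)
      have h1 : |x i| ≤ R := ((PiLp.norm_apply_le x i).trans hxR)
      have h2 : |inner ℝ (v x) (fderiv ℝ v x e)| ≤ ‖v x‖ * ‖jacobian v x‖ := by
        refine (abs_real_inner_le_norm _ _).trans ?_
        gcongr
        refine ((fderiv ℝ v x).le_opNorm e).trans ?_
        simp only [he, PiLp.norm_single, norm_one, mul_one]
        exact norm_fderiv_le_norm_jacobian v x
      have h3 : |x i| * |inner ℝ (v x) (fderiv ℝ v x e)| ≤ R * (‖v x‖ * ‖jacobian v x‖) :=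
        mul_le_mul h1 h2 (abs_nonneg _) ((abs_nonneg _).trans h1)
      rw [← abs_mul] at h3
      have h4 := neg_abs_le (x i * inner ℝ (v x) (fderiv ℝ v x e))
      nlinarith [sq_nonneg (‖v x‖ - 2 * (R * ‖jacobian v x‖))]
    · rw [image_eq_zero_of_notMem_tsupport hx]
      simp only [inner_zero_left, mul_zero, neg_zero]
      positivity
  have hiv : Integrable fun x => ‖v x‖ ^ 2 := hint _ (by fun_prop) (by simp +contextual)
  have hij : Integrable fun x => ‖jacobian v x‖ ^ 2 := by
    refine Continuous.integrable_of_hasCompactSupport (by fun_prop)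
      ((HasCompactSupport.jacobian hv.2.1).mono fun x hx h0 => hx ?_)
    simp [h0]
  have h5 : ∫ x, -(x i * (2 * inner ℝ (v x) (fderiv ℝ v x e))) ≤
      ∫ x, (‖v x‖ ^ 2 / 2 + 2 * R ^ 2 * ‖jacobian v x‖ ^ 2) := by
    refine integral_mono (hint _ (by fun_prop) (by simp +contextual)) ?_ hpt
    exact (hiv.div_const 2).add (hij.const_mul _)
  rw [integral_neg, h, neg_neg, integral_add (hiv.div_const 2) (hij.const_mul _),
    integral_div, integral_const_mul] at h5
  linarith

/-- **Poincaré's inequality**: on `H¹₀` of a bounded set the gradient controls the `H¹` norm. -/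
theorem exists_norm_le_norm_snd {D : Set (Vec d)} (hD : Bornology.IsBounded D) :
    ∃ C : ℝ, ∀ U ∈ V0 D, ‖U‖ ≤ C * ‖U.snd‖ := by
  obtain ⟨R, hR⟩ := hD.exists_norm_le
  suffices h : ∀ U ∈ V0 D, ‖U.fst‖ ^ 2 ≤ 4 * R ^ 2 * ‖U.snd‖ ^ 2 by
    refine ⟨√(4 * R ^ 2 + 1), fun U hU => ?_⟩
    refine abs_le_of_sq_le_sq' ?_ (by positivity) |>.2
    rw [norm_sq_eq_add, mul_pow, Real.sq_sqrt (by positivity)]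
    linarith [h U hU]
  intro U hU
  refine V0_induction (p := fun U => ‖U.fst‖ ^ 2 ≤ 4 * R ^ 2 * ‖U.snd‖ ^ 2) ?_ ?_ hU
  · refine isClosed_le ?_ ?_
    · exact (WithLp.fstL 2 ℝ _ _).continuous.norm.pow 2
    · exact continuous_const.mul ((WithLp.sndL 2 ℝ _ _).continuous.norm.pow 2)
  · intro U v hv h1 h2
    have e1 : ‖U.fst‖ ^ 2 = ∫ x, ‖v x‖ ^ 2 := by
      rw [norm_sq_eq_integral, ← hv.setIntegral_eq]
      · refine integral_congr_ae ?_
        filter_upwards [h1] with x hx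
        rw [hx]
      · intro x hx
        simp [image_eq_zero_of_notMem_tsupport hx]
    have e2 : ‖U.snd‖ ^ 2 = ∫ x, ‖jacobian v x‖ ^ 2 := by
      rw [norm_sq_eq_integral, ← hv.setIntegral_eq]
      · refine integral_congr_ae ?_
        filter_upwards [h2] with x hx
        rw [hx]
      · intro x hx
        simp [image_eq_zero_of_notMem_tsupport (fun h => hx (tsupport_jacobian_subset v h))]
    rw [e1, e2]
    -- In dimension 0 there is no coordinate to integrate against, but all fields vanish.
    rcases d.eq_zero_or_pos with rfl | hd
    · have : ∀ x, v x = 0 := fun x => Subsingleton.elim _ _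
      simp only [this, norm_zero]
      simp only [ne_eq, OfNat.ofNat_ne_zero, not_false_eq_true, zero_pow, integral_zero]
      positivity
    · exact hv.poincare ⟨0, hd⟩ hR

/-! ### Restriction to a block and compactness of V(K) in L²(K) -/

theorem restr_fst_ae_eq (μ : Measure (Vec d)) (K : Set (Vec d)) (U : SobPair d μ) :
    (restr μ K U).fst =ᵐ[μ.restrict K] U.fst := LpToLpRestrictCLM_coeFn ℝ K U.fst

theorem restr_snd_ae_eq (μ : Measure (Vec d)) (K : Set (Vec d)) (U : SobPair d μ) :
    (restr μ K U).snd =ᵐ[μ.restrict K] U.snd := LpToLpRestrictCLM_coeFn ℝ K U.snd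

theorem continuous_restr (μ : Measure (Vec d)) (K : Set (Vec d)) : Continuous (restr μ K) := by
  have h1 : Continuous fun U : SobPair d μ => LpToLpRestrictCLM (Vec d) (Vec d) ℝ μ 2 K U.fst :=
    (LpToLpRestrictCLM (Vec d) (Vec d) ℝ μ 2 K).continuous.comp (WithLp.fstL 2 ℝ _ _).continuous
  have h2 : Continuous fun U : SobPair d μ => LpToLpRestrictCLM (Vec d) (Mat d) ℝ μ 2 K U.snd :=
    (LpToLpRestrictCLM (Vec d) (Mat d) ℝ μ 2 K).continuous.comp (WithLp.sndL 2 ℝ _ _).continuous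
  exact (WithLp.prod_continuous_toLp 2 _ _).comp (h1.prodMk h2)

theorem restr_mem_VLoc {D K : Set (Vec d)} {U : SobPair d (volume.restrict D)} (hU : U ∈ V0 D) :
    restr (volume.restrict D) K U ∈ VLoc D K :=
  Submodule.le_topologicalClosure _ ⟨U, hU, rfl⟩

/-- A null frontier allows the closed block to be exchanged for its interior, the open set on which
the cone condition is stated. -/
theorem restrict_restrict_eq_interior {D K : Set (Vec d)} (hK : IsClosed K)
    (hKD : interior K ⊆ D) (hfr : volume (frontier K) = 0) :
    (volume.restrict D).restrict K = volume.restrict (interior K) := by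
  rw [Measure.restrict_restrict hK.measurableSet]
  refine Measure.restrict_congr_set (EventuallyLE.antisymm ?_ ?_)
  · exact (inter_subset_left (s := K) (t := D)).eventuallyLE.trans
      (interior_ae_eq_of_null_frontier hfr).symm.le
  · exact (subset_inter interior_subset hKD).eventuallyLE

/-- Elements of `V(K)` are limits of restrictions of test fields. -/
theorem exists_isTestField_norm_sub_lt {D K : Set (Vec d)}
    {u : SobPair d ((volume.restrict D).restrict K)} (hu : u ∈ VLoc D K) {ε : ℝ} (hε : 0 < ε) :
    ∃ (w : SobPair d ((volume.restrict D).restrict K)) (v : Vec d → Vec d), IsTestField D v ∧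
      (w.fst : Vec d → Vec d) =ᵐ[(volume.restrict D).restrict K] v ∧
      (w.snd : Vec d → Mat d) =ᵐ[(volume.restrict D).restrict K] jacobian v ∧ ‖u - w‖ < ε := by
  set P := Submodule.span ℝ {U : SobPair d (volume.restrict D) | ∃ v : Vec d → Vec d,
    IsTestField D v ∧ (U.fst : Vec d → Vec d) =ᵐ[volume.restrict D] v ∧
    (U.snd : Vec d → Mat d) =ᵐ[volume.restrict D] jacobian v} with hP
  have h1 : u ∈ closure (restr (volume.restrict D) K '' (P : Set (SobPair d (volume.restrict D)))) := by
    refine closure_minimal ?_ isClosed_closure hu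
    exact image_closure_subset_closure_image (continuous_restr _ _)
  obtain ⟨_, ⟨W, hW, rfl⟩, hlt⟩ := Metric.mem_closure_iff.1 h1 ε hε
  obtain ⟨v, hv, hv1, hv2⟩ := exists_isTestField_of_mem_span hW
  refine ⟨_, v, hv, (restr_fst_ae_eq _ _ _).trans (ae_restrict_of_ae hv1),
    (restr_snd_ae_eq _ _ _).trans (ae_restrict_of_ae hv2), ?_⟩
  rwa [← dist_eq_norm]

/-- The embedding of `V(K)` into `L²(K)` is compact. -/
theorem exists_subseq_cauchySeq_fst {D K : Set (Vec d)} (hK : IsClosed K)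
    (hKD : interior K ⊆ D) (hfr : volume (frontier K) = 0)
    (hKb : Bornology.IsBounded (interior K)) (hcone : ConeCondition (interior K))
    (u : ℕ → SobPair d ((volume.restrict D).restrict K)) (M : ℝ)
    (hu : ∀ n, u n ∈ VLoc D K) (hM : ∀ n, ‖u n‖ ≤ M) :
    ∃ φ : ℕ → ℕ, StrictMono φ ∧ CauchySeq fun n => (u (φ n)).fst := by
  have hμ := restrict_restrict_eq_interior hK hKD hfr
  -- Each u n is replaced by the restriction of a smooth test field at distance less than 1/(n+1).
  -- Rellich's theorem applies to these with bound M + 1, and the replacement error vanishes in the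
  -- limit.
  choose w v hv hw1 hw2 hlt using fun n : ℕ =>
    exists_isTestField_norm_sub_lt (hu n) (Nat.one_div_pos_of_nat (α := ℝ) (n := n))
  have hwM : ∀ n, ‖w n‖ₑ ≤ ENNReal.ofReal (M + 1) := fun n => by
    rw [← ofReal_norm]
    refine ENNReal.ofReal_le_ofReal ?_
    have h1 : (1 : ℝ) / (n + 1) ≤ 1 := by
      rw [div_le_one (by positivity)]
      linarith [(Nat.cast_nonneg n : (0 : ℝ) ≤ n)]
    have h2 := norm_sub_norm_le (w n) (u n)
    rw [norm_sub_rev] at h2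
    linarith [hlt n, hM n]
  have e1 : ∀ n, ∫⁻ x in interior K, ‖v n x‖ₑ ^ 2 ≤ ENNReal.ofReal (M + 1) ^ 2 := fun n => by
    rw [← hμ]
    calc ∫⁻ x in K, ‖v n x‖ₑ ^ 2 ∂(volume.restrict D) = ‖(w n).fst‖ₑ ^ 2 := by
          rw [enorm_sq_eq_lintegral]
          refine lintegral_congr_ae ?_
          filter_upwards [hw1 n] with x hx
          rw [hx]
      _ ≤ _ := pow_le_pow_left₀ zero_le ((WithLp.enorm_fst_le _ _).trans (hwM n)) 2
  have e2 : ∀ n, ∫⁻ x in interior K, ‖fderiv ℝ (v n) x‖ₑ ^ 2 ≤ ENNReal.ofReal (M + 1) ^ 2 :=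
    fun n => by
    rw [← hμ]
    calc ∫⁻ x in K, ‖fderiv ℝ (v n) x‖ₑ ^ 2 ∂(volume.restrict D)
        ≤ ∫⁻ x in K, ‖jacobian (v n) x‖ₑ ^ 2 ∂(volume.restrict D) :=
          lintegral_mono fun x => pow_le_pow_left₀ zero_le (by
            rw [← ofReal_norm, ← ofReal_norm]
            exact ENNReal.ofReal_le_ofReal (norm_fderiv_le_norm_jacobian _ _)) 2
      _ = ‖(w n).snd‖ₑ ^ 2 := by
          rw [enorm_sq_eq_lintegral]
          refine lintegral_congr_ae ?_
          filter_upwards [hw2 n] with x hx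
          rw [hx]
      _ ≤ _ := pow_le_pow_left₀ zero_le ((WithLp.enorm_snd_le _ _).trans (hwM n)) 2
  obtain ⟨φ, hφ, hlim⟩ := exists_subseq_tendsto_lintegral_sub_sq isOpen_interior hKb hcone v
    (fun n => (hv n).contDiff_one) _ (ENNReal.pow_ne_top ENNReal.ofReal_ne_top) e1 e2
  refine ⟨φ, hφ, ?_⟩
  rw [cauchySeq_iff_tendsto_dist_atTop_0]
  have hww : Tendsto (fun p : ℕ × ℕ => ‖(w (φ p.1)).fst - (w (φ p.2)).fst‖) atTop (𝓝 0) := by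
    have h1 : ∀ p : ℕ × ℕ, ∫⁻ x in interior K, ‖v (φ p.1) x - v (φ p.2) x‖ₑ ^ 2 =
        ‖(w (φ p.1)).fst - (w (φ p.2)).fst‖ₑ ^ 2 := fun p => by
      rw [enorm_sq_eq_lintegral, ← hμ]
      refine lintegral_congr_ae ?_
      filter_upwards [hw1 (φ p.1), hw1 (φ p.2), Lp.coeFn_sub (w (φ p.1)).fst (w (φ p.2)).fst]
        with x hx1 hx2 hx3
      rw [hx3, Pi.sub_apply, hx1, hx2]
    simp only [h1] at hlim
    have h2 := (ENNReal.tendsto_toReal (by simp)).comp hlim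
    have h3 := h2.sqrt
    simpa [Function.comp_def, ENNReal.toReal_pow, Real.sqrt_sq] using h3
  have huw : Tendsto (fun n => ‖(u (φ n)).fst - (w (φ n)).fst‖) atTop (𝓝 0) := by
    refine squeeze_zero (fun _ => norm_nonneg _) (fun n => ?_)
      (tendsto_one_div_add_atTop_nhds_zero_nat.comp hφ.tendsto_atTop)
    refine le_trans ?_ (hlt (φ n)).le
    rw [← WithLp.sub_fst]
    exact WithLp.norm_fst_le _ _
  rw [← prod_atTop_atTop_eq] at hww ⊢
  have hsum := ((huw.comp tendsto_fst).add hww).add (huw.comp tendsto_snd)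
  simp only [add_zero, Function.comp_apply] at hsum
  refine squeeze_zero (fun _ => dist_nonneg) (fun p => ?_) hsum
  rw [← dist_eq_norm, ← dist_eq_norm, ← dist_eq_norm, dist_comm (u (φ p.2)).fst]
  exact dist_triangle4 _ _ _ _

/-! ### The weight as an operator and the local spectral gap -/

section Weight

/-- Multiplication by `√κ` as an operator on `L²`. -/
theorem exists_sqrt_mul_operator {μ : Measure (Vec d)} {κ : Vec d → ℝ} (hκ : Measurable κ) {M : ℝ}
    (hM : ∀ᵐ x ∂μ, κ x ≤ M) :
    ∃ T : Lp (Vec d) 2 μ →L[ℝ] Lp (Vec d) 2 μ, ∀ u, T u =ᵐ[μ] fun x => √(κ x) • u x := by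
  have hmem : MemLp (fun x => √(κ x)) ⊤ μ := by
    refine memLp_top_of_bound hκ.sqrt.aestronglyMeasurable (√M) ?_
    filter_upwards [hM] with x hx
    rw [Real.norm_of_nonneg (Real.sqrt_nonneg _)]
    exact Real.sqrt_le_sqrt hx
  refine ⟨(ContinuousLinearMap.lsmul ℝ ℝ : ℝ →L[ℝ] Vec d →L[ℝ] Vec d).holderL μ ⊤ 2 2
    (hmem.toLp _), fun u => ?_⟩
  refine (ContinuousLinearMap.coeFn_holder _ (hmem.toLp _) u).trans ?_
  filter_upwards [hmem.coeFn_toLp] with x hx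
  rw [hx]
  rfl

variable {μ : Measure (Vec d)} {κ : Vec d → ℝ} {T : Lp (Vec d) 2 μ →L[ℝ] Lp (Vec d) 2 μ}

/-- Realizes s as the inner product pulled back by multiplication with √κ, which is the role of `T`
in the abstract theorems. -/
theorem sForm_eq_inner (hT : ∀ u, T u =ᵐ[μ] fun x => √(κ x) • u x) (h0 : ∀ᵐ x ∂μ, 0 ≤ κ x)
    (U V : SobPair d μ) : sForm κ U V = inner ℝ (T U.fst) (T V.fst) := by
  rw [L2.inner_def]
  refine integral_congr_ae ?_
  filter_upwards [hT U.fst, hT V.fst, h0] with x h1 h2 h3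
  rw [h1, h2, real_inner_smul_left, real_inner_smul_right, ← mul_assoc, Real.mul_self_sqrt h3]

theorem eq_zero_of_sqrt_mul_eq_zero (hT : ∀ u, T u =ᵐ[μ] fun x => √(κ x) • u x)
    (h0 : ∀ᵐ x ∂μ, 0 < κ x) (u : Lp (Vec d) 2 μ) (hu : T u = 0) : u = 0 := by
  rw [Lp.eq_zero_iff_ae_eq_zero] at hu ⊢
  filter_upwards [hu, hT u, h0] with x h1 h2 h3
  rw [h1] at h2
  exact (smul_eq_zero.1 h2.symm).resolve_left (Real.sqrt_pos.2 h3).ne'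

theorem sForm_self_nonneg (h0 : ∀ᵐ x ∂μ, 0 ≤ κ x) (U : SobPair d μ) : 0 ≤ sForm κ U U := by
  refine integral_nonneg_of_ae ?_
  filter_upwards [h0] with x hx
  exact mul_nonneg hx real_inner_self_nonneg

end Weight

/-- An instance of `eigenvalue_mul_le` with L the field, G the gradient and T the field times √κ.
Boundedness of κ makes T continuous, and positivity almost everywhere makes it injective. -/
theorem IsEigenSystem.eigenvalue_mul_sForm_le {D K : Set (Vec d)} (hK : IsClosed K)
    (hKD : interior K ⊆ D) (hfr : volume (frontier K) = 0)
    (hKb : Bornology.IsBounded (interior K)) (hcone : ConeCondition (interior K))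
    {κ : Vec d → ℝ} (hκ : Measurable κ) {M : ℝ} (hM : ∀ᵐ x ∂(volume.restrict D), κ x ≤ M)
    (h0 : ∀ᵐ x ∂(volume.restrict D), 0 < κ x)
    {φ : ℕ → SobPair d ((volume.restrict D).restrict K)} {lam : ℕ → ℝ}
    (hφ : IsEigenSystem D K κ φ lam) (l : ℕ) {e : SobPair d ((volume.restrict D).restrict K)}
    (he : e ∈ VLoc D K) (hel : ∀ j < l, sForm κ e (φ j) = 0) :
    lam l * sForm κ e e ≤ aForm e e := by
  obtain ⟨T, hT⟩ := exists_sqrt_mul_operator (μ := (volume.restrict D).restrict K) hκ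
    (ae_restrict_of_ae hM)
  have h0' : ∀ᵐ x ∂((volume.restrict D).restrict K), 0 < κ x := ae_restrict_of_ae h0
  have hs := sForm_eq_inner hT (h0'.mono fun _ => le_of_lt)
  have key := eigenvalue_mul_le
    (L := WithLp.fstL 2 ℝ (Lp (Vec d) 2 ((volume.restrict D).restrict K))
      (Lp (Mat d) 2 ((volume.restrict D).restrict K)))
    (G := WithLp.sndL 2 ℝ (Lp (Vec d) 2 ((volume.restrict D).restrict K))
      (Lp (Mat d) 2 ((volume.restrict D).restrict K)))
    (T := T.comp (WithLp.fstL 2 ℝ (Lp (Vec d) 2 ((volume.restrict D).restrict K))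
      (Lp (Mat d) 2 ((volume.restrict D).restrict K)))) (c := ‖T‖)
    norm_sq_eq_add (fun v hv => eq_zero_of_sqrt_mul_eq_zero hT h0' _ hv)
    (fun v => T.le_opNorm _) (VLoc D K) (Submodule.isClosed_topologicalClosure _)
    (exists_subseq_cauchySeq_fst hK hKD hfr hKb hcone) (φ := φ) (lam := lam)
    (fun j => (hφ.eigenpair j).1)
    (fun j v hv => by
      have := (hφ.eigenpair j).2 v hv
      rw [aForm_eq_inner, hs] at this
      exact this)
    (fun j k => by rw [← hφ.orthonormal j k, hs]; rfl) hφ.mono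
    (fun ψ hψ m hm => hφ.exhaustive ψ m ⟨hψ, fun v hv => by
      rw [aForm_eq_inner, hs]
      exact hm v hv⟩) l he
    (fun j hj => by rw [← hel j hj, hs]; rfl)
  rw [hs, aForm_eq_inner, real_inner_self_eq_norm_sq, real_inner_self_eq_norm_sq]
  exact key

/-! ### Summation over coarse blocks and bounds for the weight -/

section Grid

variable {N : ℕ} {D : Set (Vec d)} {K : Fin N → Set (Vec d)}

/-- The blocks equal their interiors up to null sets, so disjointness of the interiors makes them
disjoint almost everywhere. -/
theorem IsCoarseGrid.restrict_eq_sum (h : IsCoarseGrid D K) :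
    volume.restrict D = Measure.sum fun i => (volume.restrict D).restrict (K i) := by
  have hd : Pairwise (Function.onFun (AEDisjoint (volume.restrict D)) K) := by
    intro i j hij
    have hae : ∀ i, (K i : Set (Vec d)) =ᵐ[volume.restrict D] interior (K i) := fun i =>
      (ae_mono Measure.restrict_le_self) (interior_ae_eq_of_null_frontier (h.frontier_null i)).symm
    exact (h.disjoint hij).aedisjoint.congr (hae i) (hae j)
  rw [← Measure.restrict_iUnion_ae hd fun i => (h.isClosed i).nullMeasurableSet,
    Measure.restrict_restrict (MeasurableSet.iUnion fun i => (h.isClosed i).measurableSet),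
    inter_eq_right.2 h.cover]

theorem IsCoarseGrid.sum_integral (h : IsCoarseGrid D K) {f : Vec d → ℝ}
    (hf : Integrable f (volume.restrict D)) :
    ∑ i, ∫ x in K i, f x ∂(volume.restrict D) = ∫ x in D, f x := by
  have h1 := h.restrict_eq_sum
  rw [Measure.sum_fintype] at h1
  conv_rhs => rw [h1]
  rw [integral_finsetSum_measure fun i _ => hf.restrict]

theorem IsCoarseGrid.sum_aForm_restr (h : IsCoarseGrid D K) (U : SobPair d (volume.restrict D)) :
    ∑ i, aForm (restr (volume.restrict D) (K i) U) (restr (volume.restrict D) (K i) U) =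
      aForm U U := by
  rw [aForm, ← h.sum_integral (by simpa using integrable_norm_sq U.snd)]
  refine Finset.sum_congr rfl fun i _ => integral_congr_ae ?_
  filter_upwards [restr_snd_ae_eq (volume.restrict D) (K i) U] with x hx
  rw [hx]

theorem IsCoarseGrid.sum_sForm_restr (h : IsCoarseGrid D K) {κ : Vec d → ℝ}
    (hκ : Measurable κ) {M : ℝ} (hM : ∀ᵐ x ∂(volume.restrict D), κ x ≤ M)
    (h0 : ∀ᵐ x ∂(volume.restrict D), 0 ≤ κ x) (U : SobPair d (volume.restrict D)) :
    ∑ i, sForm κ (restr (volume.restrict D) (K i) U) (restr (volume.restrict D) (K i) U) =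
      sForm κ U U := by
  have hint : Integrable (fun x => κ x * inner ℝ (U.fst x) (U.fst x)) (volume.restrict D) := by
    refine Integrable.bdd_mul (c := M) (by simpa using integrable_norm_sq U.fst)
      hκ.aestronglyMeasurable ?_
    filter_upwards [hM, h0] with x h1 h2
    rwa [Real.norm_of_nonneg h2]
  rw [sForm, ← h.sum_integral hint]
  refine Finset.sum_congr rfl fun i _ => integral_congr_ae ?_
  filter_upwards [restr_fst_ae_eq (volume.restrict D) (K i) U] with x hx
  rw [hx]

end Grid

theorem measurable_gradient (f : Vec d → ℝ) : Measurable (gradient f) :=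
  (InnerProductSpace.toDual ℝ (Vec d)).symm.continuous.measurable.comp (measurable_fderiv ℝ f)

theorem measurable_weight {Nc : ℕ} (χ : Fin Nc → Vec d → ℝ) : Measurable (weight χ) :=
  Finset.measurable_sum _ fun j _ => (measurable_gradient (χ j)).norm.pow_const 2

theorem IsPartitionOfUnity.exists_weight_le {D : Set (Vec d)} {Nc : ℕ} {χ : Fin Nc → Vec d → ℝ}
    (h : IsPartitionOfUnity D χ) : ∃ M : ℝ, ∀ᵐ x ∂(volume.restrict D), weight χ x ≤ M := by
  obtain ⟨M, hM⟩ := h.bounded_gradient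
  refine ⟨∑ _j : Fin Nc, M ^ 2, ?_⟩
  filter_upwards [ae_all_iff.2 hM] with x hx
  exact Finset.sum_le_sum fun j _ => pow_le_pow_left₀ (norm_nonneg _) (hx j) 2

/-- Parseval's identity for the orthonormal eigenfunctions; it lets the auxiliary space be replaced
by Euclidean coefficient vectors. -/
theorem IsEigenSystem.sForm_sum_self {D K : Set (Vec d)} {κ : Vec d → ℝ} (hκ : Measurable κ) {M : ℝ}
    (hM : ∀ᵐ x ∂(volume.restrict D), κ x ≤ M) (h0 : ∀ᵐ x ∂(volume.restrict D), 0 < κ x)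
    {φ : ℕ → SobPair d ((volume.restrict D).restrict K)} {lam : ℕ → ℝ}
    (hφ : IsEigenSystem D K κ φ lam) (n : ℕ) (a : ℕ → ℝ) :
    sForm κ (∑ j ∈ Finset.range n, a j • φ j) (∑ j ∈ Finset.range n, a j • φ j) =
      ∑ j ∈ Finset.range n, a j ^ 2 := by
  obtain ⟨T, hT⟩ := exists_sqrt_mul_operator (μ := (volume.restrict D).restrict K) hκ
    (ae_restrict_of_ae hM)
  have h0' : ∀ᵐ x ∂((volume.restrict D).restrict K), 0 ≤ κ x :=
    ae_restrict_of_ae (h0.mono fun _ => le_of_lt)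
  have hs := sForm_eq_inner hT h0'
  set B := T.comp (WithLp.fstL 2 ℝ (Lp (Vec d) 2 ((volume.restrict D).restrict K))
      (Lp (Mat d) 2 ((volume.restrict D).restrict K))) with hB
  have hs' : ∀ U V, sForm κ U V = inner ℝ (B U) (B V) := hs
  have ho : ∀ j k, inner ℝ (B (φ j)) (B (φ k)) = if j = k then (1 : ℝ) else 0 := fun j k => by
    rw [← hs', hφ.orthonormal]
  rw [hs']
  simp only [map_sum, map_smul, sum_inner, inner_sum, real_inner_smul_left, real_inner_smul_right,
    ho, mul_ite, mul_one, mul_zero, Finset.sum_ite_eq', Finset.mem_range]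
  refine Finset.sum_congr rfl fun j hj => ?_
  rw [if_pos (Finset.mem_range.1 hj), pow_two]

/-! ### Error equation, orthogonality to the auxiliary space, weighted estimate -/

namespace Setting

variable (S : Setting d)

theorem isBounded_dom : Bornology.IsBounded S.dom := S.Ω_bounded.subset sdiff_subset

theorem isOpen_dom : IsOpen S.dom := S.Ω_open.sdiff isClosed_closure

theorem volume_dom_ne_top : volume S.dom ≠ ⊤ := S.isBounded_dom.measure_lt_top.ne

theorem isBounded_interior_K (i : Fin S.N) : Bornology.IsBounded (interior (S.K i)) :=
  S.isBounded_dom.subset (S.grid.interior_subset i)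

theorem measurable_κ : Measurable S.κ := measurable_weight S.χ

theorem κ_pos : ∀ᵐ x ∂S.vol, 0 < S.κ x := S.partition.weight_pos

theorem Λ_le (i : Fin S.N) : S.Λ ≤ S.lam i (S.ℓ i) := ciInf_le (finite_range _).bddBelow i

/-- The coefficients of `π v` in the basis of `V_aux`. -/
theorem exists_coefficient_operator :
    ∃ P : SobPair d S.vol →L[ℝ] EuclideanSpace ℝ (Σ i : Fin S.N, Fin (S.ℓ i)),
      ∀ v k, P v k = sForm S.κ (restr S.vol (S.K k.1) v) (S.φ k.1 k.2) := by
  obtain ⟨M, hM⟩ := S.partition.exists_weight_le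
  choose T hT using fun i : Fin S.N => exists_sqrt_mul_operator
    (μ := (volume.restrict S.dom).restrict (S.K i)) S.measurable_κ (ae_restrict_of_ae hM)
  have hs := fun i => sForm_eq_inner (hT i)
    (ae_restrict_of_ae (S.κ_pos.mono fun _ => le_of_lt))
  let R : (i : Fin S.N) → SobPair d S.vol →L[ℝ] SobPair d (S.vol.restrict (S.K i)) :=
    fun i => ⟨restr S.vol (S.K i), continuous_restr _ _⟩
  refine ⟨(EuclideanSpace.equiv (Σ i : Fin S.N, Fin (S.ℓ i)) ℝ).symm.toContinuousLinearMap.comp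
    (ContinuousLinearMap.pi fun k => (innerSL ℝ (T k.1 (S.φ k.1 k.2).fst)).comp
      ((T k.1).comp ((WithLp.fstL 2 ℝ _ _).comp (R k.1)))), fun v k => ?_⟩
  rw [hs, real_inner_comm]
  rfl

/-- Puts the defining functional into the form required by `apply_eq_zero_of_orthogonal_minimizers`,
with coefficient vectors in place of elements of the auxiliary space. -/
theorem cemEnergy_eq {P : SobPair d S.vol →L[ℝ] EuclideanSpace ℝ (Σ i : Fin S.N, Fin (S.ℓ i))}
    (hP : ∀ v k, P v k = sForm S.κ (restr S.vol (S.K k.1) v) (S.φ k.1 k.2))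
    (k : Σ i : Fin S.N, Fin (S.ℓ i)) (ψ : SobPair d S.vol) :
    S.cemEnergy k.1 k.2 ψ =
      ‖ψ.snd‖ ^ 2 + ‖P ψ - EuclideanSpace.single k (1 : ℝ)‖ ^ 2 := by
  obtain ⟨M, hM⟩ := S.partition.exists_weight_le
  rw [cemEnergy, aForm_eq_inner, real_inner_self_eq_norm_sq, EuclideanSpace.norm_sq_eq,
    Fintype.sum_sigma, Setting.s]
  congr 1
  refine Finset.sum_congr rfl fun i _ => ?_
  obtain ⟨i₀, j₀⟩ := k
  set a : ℕ → ℝ := fun j => sForm S.κ (restr S.vol (S.K i) ψ) (S.φ i j) -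
    if i = i₀ ∧ j = j₀ then 1 else 0 with ha
  have h1 : (S.proj ψ - S.auxBasis i₀ j₀) i = ∑ j ∈ Finset.range (S.ℓ i), a j • S.φ i j := by
    simp only [ha, sub_smul, Finset.sum_sub_distrib, Pi.sub_apply, Setting.proj]
    congr 1
    by_cases hi : i = i₀
    · subst hi
      simp [auxBasis]
    · simp [auxBasis, hi]
  rw [h1, (S.eigen i).sForm_sum_self S.measurable_κ hM S.κ_pos, Finset.sum_range]
  refine Finset.sum_congr rfl fun j _ => ?_
  rw [Real.norm_eq_abs, sq_abs, PiLp.sub_apply, hP]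
  simp only [ha]
  congr 2
  rw [PiLp.single_apply]
  congr 1
  rw [eq_iff_iff]
  constructor
  · rintro ⟨rfl, h⟩
    rw [Fin.val_inj] at h
    rw [h]
  · intro h
    cases h
    exact ⟨rfl, rfl⟩

theorem Vglo_le : S.Vglo ≤ V0divSubmodule S.dom := by
  refine Submodule.span_le.2 ?_
  rintro ψ ⟨i, j, -, hψ, -⟩
  rw [coe_V0divSubmodule]
  exact hψ

variable {S} {f : Lp (Vec d) 2 S.vol} {u uglo : SobPair d S.vol} {p : Lp ℝ 2 S.vol}

/-- The divergence of an H¹₀ field has zero mean, so it may be used as q in the mass equation, which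
then says that its L² norm is zero. -/
theorem IsStokesSolution.mem_V0divSubmodule (h : S.IsStokesSolution f u p) :
    u ∈ V0divSubmodule S.dom := by
  refine ⟨h.mem, ?_⟩
  have h1 := h.mass (divL S.vol u) (integral_divL_eq_zero S.volume_dom_ne_top h.mem)
  rw [bForm_eq_inner, inner_self_eq_zero] at h1
  exact h1

theorem IsStokesSolution.aForm_eq (h : S.IsStokesSolution f u p) {v : SobPair d S.vol}
    (hv : v ∈ V0divSubmodule S.dom) : aForm u v = inner ℝ f v.fst := by
  have h1 := h.momentum v hv.1
  rw [bForm_eq_inner, show divL S.vol v = 0 from hv.2, inner_zero_left, sub_zero] at h1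
  exact h1

/-- Galerkin orthogonality. -/
theorem inner_snd_error_eq_zero (hu : S.IsStokesSolution f u p) (hw : S.IsGlobalSolution f uglo)
    {v : SobPair d S.vol} (hv : v ∈ S.Vglo) : inner ℝ (u - uglo).snd v.snd = (0 : ℝ) := by
  have h1 := hu.aForm_eq (S.Vglo_le hv)
  have h2 := hw.galerkin v hv
  rw [aForm_eq_inner] at h1 h2
  rw [WithLp.sub_snd, inner_sub_left, h1, h2, sub_self]

theorem error_mem (hu : S.IsStokesSolution f u p) (hw : S.IsGlobalSolution f uglo) :
    u - uglo ∈ V0divSubmodule S.dom :=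
  Submodule.sub_mem _ hu.mem_V0divSubmodule (S.Vglo_le hw.mem)

/-- The error is divergence-free, so a(u, e) = ⟨f, e⟩ without a pressure term, while a(u_glo, e) = 0
by Galerkin orthogonality. -/
theorem aForm_error_eq (hu : S.IsStokesSolution f u p) (hw : S.IsGlobalSolution f uglo) :
    aForm (u - uglo) (u - uglo) = inner ℝ f (u - uglo).fst := by
  rw [← hu.aForm_eq (error_mem hu hw), aForm_eq_inner, aForm_eq_inner]
  have h1 := inner_snd_error_eq_zero hu hw hw.mem
  rw [real_inner_comm] at h1
  conv_lhs => rw [WithLp.sub_snd u uglo, inner_sub_left, ← WithLp.sub_snd, h1, sub_zero]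

/-- The error is orthogonal to the auxiliary space. -/
theorem sForm_error_eq_zero (hu : S.IsStokesSolution f u p) (hw : S.IsGlobalSolution f uglo)
    (i : Fin S.N) (j : ℕ) (hj : j < S.ℓ i) :
    sForm S.κ (restr S.vol (S.K i) (u - uglo)) (S.φ i j) = 0 := by
  obtain ⟨P, hP⟩ := S.exists_coefficient_operator
  obtain ⟨C, hC⟩ := exists_norm_le_norm_snd S.isBounded_dom
  have key := apply_eq_zero_of_orthogonal_minimizers
    (WithLp.sndL 2 ℝ (Lp (Vec d) 2 S.vol) (Lp (Mat d) 2 S.vol)) P (V0divSubmodule S.dom)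
    (isClosed_V0divSubmodule _) (C := C) (fun v hv => hC v hv.1) (error_mem hu hw) ?_
  · rw [← hP _ ⟨i, ⟨j, hj⟩⟩, key]
    rfl
  · intro k ψ hψ hmin
    have hmem : ψ ∈ S.Vglo := by
      refine Submodule.subset_span ⟨k.1, k.2, k.2.2, ?_, ?_⟩
      · rw [← coe_V0divSubmodule]
        exact hψ
      · rw [← coe_V0divSubmodule]
        have : S.cemEnergy k.1 k.2 = _ := funext fun ψ => S.cemEnergy_eq hP k ψ
        rw [this]
        exact hmin
    have h1 := inner_snd_error_eq_zero hu hw hmem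
    rw [real_inner_comm] at h1
    exact h1

/-- Orthogonality to the selected eigenfunctions gives the local gap inequality on each block; both
forms are additive over the blocks. -/
theorem Λ_mul_sForm_error_le (hu : S.IsStokesSolution f u p) (hw : S.IsGlobalSolution f uglo) :
    S.Λ * sForm S.κ (u - uglo) (u - uglo) ≤ aForm (u - uglo) (u - uglo) := by
  obtain ⟨M, hM⟩ := S.partition.exists_weight_le
  have h0 : ∀ᵐ x ∂S.vol, 0 ≤ S.κ x := S.κ_pos.mono fun _ => le_of_lt
  rw [← S.grid.sum_sForm_restr S.measurable_κ hM h0, ← S.grid.sum_aForm_restr, Finset.mul_sum]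
  refine Finset.sum_le_sum fun i _ => ?_
  refine le_trans (mul_le_mul_of_nonneg_right (S.Λ_le i)
    (sForm_self_nonneg (ae_restrict_of_ae h0) _)) ?_
  exact (S.eigen i).eigenvalue_mul_sForm_le (S.grid.isClosed i) (S.grid.interior_subset i)
    (S.grid.frontier_null i) (S.isBounded_interior_K i) (S.grid.cone i) S.measurable_κ hM S.κ_pos
    (S.ℓ i) (restr_mem_VLoc (error_mem hu hw).1) fun j hj => sForm_error_eq_zero hu hw i j hj

/-- The error estimate in the weighted norm. -/
theorem energyNorm_error_le (hu : S.IsStokesSolution f u p) (hw : S.IsGlobalSolution f uglo)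
    (hΛ : 0 < S.Λ) :
    ENNReal.ofReal (energyNorm (u - uglo)) ≤ ENNReal.ofReal (S.Λ ^ (-(1 / 2) : ℝ)) *
      eLpNorm (fun x => (S.κ x) ^ (-(1 / 2) : ℝ) • f x) 2 S.vol := by
  obtain ⟨M, hM⟩ := S.partition.exists_weight_le
  obtain ⟨T, hT⟩ := exists_sqrt_mul_operator (μ := S.vol) S.measurable_κ hM
  have h0 : ∀ᵐ x ∂S.vol, 0 ≤ S.κ x := S.κ_pos.mono fun _ => le_of_lt
  have h1 := Λ_mul_sForm_error_le hu hw
  have h2 := aForm_error_eq hu hw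
  set e := u - uglo with he
  rw [energyNorm_eq_norm]
  rw [sForm_eq_inner hT h0, aForm_eq_inner, real_inner_self_eq_norm_sq,
    real_inner_self_eq_norm_sq] at h1
  rw [aForm_eq_inner, real_inner_self_eq_norm_sq] at h2
  set A := eLpNorm (fun x => (S.κ x) ^ (-(1 / 2) : ℝ) • f x) 2 S.vol with hA
  have hTe : ‖T e.fst‖ ≤ S.Λ ^ (-(1 / 2) : ℝ) * ‖e.snd‖ := by
    have hpos : 0 < S.Λ ^ (-(1 / 2) : ℝ) := Real.rpow_pos_of_pos hΛ _
    refine abs_le_of_sq_le_sq' ?_ (by positivity) |>.2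
    rw [mul_pow, ← Real.rpow_natCast (S.Λ ^ _), ← Real.rpow_mul hΛ.le]
    norm_num
    rw [Real.rpow_neg_one, inv_mul_eq_div, le_div_iff₀ hΛ, mul_comm]
    exact h1
  -- The weights κ^(-1/2) and κ^(1/2) cancel almost everywhere in f · e. Hölder's inequality in
  -- `ℝ≥0∞` covers the case where the weighted norm of f is infinite.
  have hmain : ENNReal.ofReal (‖e.snd‖ ^ 2) ≤ A * ‖T e.fst‖ₑ := by
    rw [h2, L2.inner_def]
    calc ENNReal.ofReal (∫ x, inner ℝ (f x) (e.fst x) ∂S.vol)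
        ≤ ‖∫ x, inner ℝ (f x) (e.fst x) ∂S.vol‖ₑ := by
          rw [← ofReal_norm]
          exact ENNReal.ofReal_le_ofReal (le_abs_self _)
      _ ≤ ∫⁻ x, ‖inner ℝ (f x) (e.fst x)‖ₑ ∂S.vol := enorm_integral_le_lintegral_enorm _
      _ ≤ ∫⁻ x, ‖(S.κ x) ^ (-(1 / 2) : ℝ) • f x‖ₑ * ‖T e.fst x‖ₑ ∂S.vol := by
          refine lintegral_mono_ae ?_
          filter_upwards [hT e.fst, S.κ_pos] with x hx hκ
          rw [hx, ← ofReal_norm, ← ofReal_norm, ← ofReal_norm, ← ENNReal.ofReal_mul (norm_nonneg _)]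
          refine ENNReal.ofReal_le_ofReal ((norm_inner_le_norm _ _).trans_eq ?_)
          have hp : 0 < S.κ x ^ (1 / 2 : ℝ) := Real.rpow_pos_of_pos hκ _
          rw [norm_smul, norm_smul, Real.norm_of_nonneg (Real.rpow_nonneg hκ.le _),
            Real.norm_of_nonneg (Real.sqrt_nonneg _), Real.sqrt_eq_rpow, Real.rpow_neg hκ.le]
          field_simp
      _ ≤ A * ‖T e.fst‖ₑ := by
          have hm : AEMeasurable (fun x => ‖(S.κ x) ^ (-(1 / 2) : ℝ) • f x‖ₑ) S.vol :=
            (AEStronglyMeasurable.smul (S.measurable_κ.pow_const _).aestronglyMeasurable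
              (Lp.aestronglyMeasurable f)).enorm
          have := ENNReal.lintegral_mul_le_Lp_mul_Lq S.vol (p := 2) (q := 2)
            Real.HolderConjugate.two_two hm (Lp.aestronglyMeasurable (T e.fst)).enorm
          refine this.trans_eq ?_
          rw [hA, Lp.enorm_def, eLpNorm_eq_lintegral_rpow_enorm_toReal (by norm_num) (by norm_num),
            eLpNorm_eq_lintegral_rpow_enorm_toReal (by norm_num) (by norm_num)]
          simp
  by_cases hz : ‖e.snd‖ = 0
  · simp [hz]
  have hpos : 0 < ‖e.snd‖ := lt_of_le_of_ne (norm_nonneg _) (Ne.symm hz)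
  rw [← ENNReal.mul_le_mul_iff_left (ENNReal.ofReal_pos.2 hpos).ne' ENNReal.ofReal_ne_top,
    ← ENNReal.ofReal_mul (norm_nonneg _), ← pow_two]
  refine hmain.trans ?_
  rw [mul_comm (ENNReal.ofReal _) A, mul_assoc, ← ENNReal.ofReal_mul (by positivity), ← ofReal_norm]
  exact mul_le_mul' le_rfl (ENNReal.ofReal_le_ofReal hTe)

end Setting

/-! ### Lower bound of the weight for the multilinear partition of unity -/

/-- **Rademacher's theorem** for locally Lipschitz functions on an open set. -/
theorem ae_differentiableAt_of_locallyLipschitzOn {D : Set (Vec d)} (hD : IsOpen D)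
    {g : Vec d → ℝ} (hg : LocallyLipschitzOn D g) :
    ∀ᵐ x ∂(volume.restrict D), DifferentiableAt ℝ g x := by
  rw [ae_restrict_iff' hD.measurableSet, ae_iff]
  refine measure_null_of_locally_null _ fun x hx => ?_
  simp only [Classical.not_imp, mem_ofPred_eq] at hx
  obtain ⟨C, t, ht, hC⟩ := hg hx.1
  rw [hD.nhdsWithin_eq hx.1] at ht
  obtain ⟨o, hot, ho, hxo⟩ := mem_nhds_iff.1 ht
  refine ⟨_ ∩ o, inter_mem self_mem_nhdsWithin (mem_nhdsWithin_of_mem_nhds (ho.mem_nhds hxo)), ?_⟩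
  have h1 := (hC.mono hot).ae_differentiableWithinAt_of_mem (μ := volume)
  rw [ae_iff] at h1
  refine measure_mono_null (fun y hy => ?_) h1
  simp only [Classical.not_imp, mem_inter_iff, mem_ofPred_eq] at hy ⊢
  exact ⟨hy.2, fun h => hy.1.2 (h.differentiableAt (ho.mem_nhds hy.2))⟩

theorem norm_gradient (g : Vec d → ℝ) (x : Vec d) : ‖gradient g x‖ = ‖fderiv ℝ g x‖ :=
  LinearIsometryEquiv.norm_map _ _

/-- If functions `χ j`, `j ∈ J`, reproduce the coordinates near `x` from points at mutual distance
at most `L`, then their gradients at `x` cannot all be small. -/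
theorem one_le_of_reproducing [NeZero d] {ι : Type*} {J : Finset ι} {χ : ι → Vec d → ℝ}
    {a : ι → Vec d} {b x : Vec d} {L : ℝ} (hχ : ∀ j ∈ J, DifferentiableAt ℝ (χ j) x)
    (ha : ∀ j ∈ J, ‖a j - b‖ ≤ L) (hL : 0 ≤ L)
    (hrep : ∀ᶠ y in 𝓝 x, y - b = ∑ j ∈ J, χ j y • (a j - b)) :
    1 ≤ L ^ 2 * (J.card * ∑ j ∈ J, ‖gradient (χ j) x‖ ^ 2) := by
  have h1 : HasFDerivAt (fun y : Vec d => y - b) (ContinuousLinearMap.id ℝ (Vec d)) x :=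
    (hasFDerivAt_id x).sub_const b
  have h2 : HasFDerivAt (fun y : Vec d => ∑ j ∈ J, χ j y • (a j - b))
      (∑ j ∈ J, (fderiv ℝ (χ j) x).smulRight (a j - b)) x :=
    HasFDerivAt.fun_sum fun j hj => (hχ j hj).hasFDerivAt.smul_const _
  -- Differentiating the reproduction identity shows that the identity map is the sum of the
  -- rank-one maps ∇χ_j ⊗ (a_j - b). Evaluation at a unit vector gives 1 ≤ L ∑ ‖∇χ_j‖, and
  -- Cauchy–Schwarz over `J` the squared form.
  have h3 := h1.unique (h2.congr_of_eventuallyEq hrep)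
  set w : Vec d := EuclideanSpace.single 0 (1 : ℝ) with hw
  have hw1 : ‖w‖ = 1 := by simp [hw]
  have h4 : w = ∑ j ∈ J, fderiv ℝ (χ j) x w • (a j - b) := by
    have := DFunLike.congr_fun h3 w
    simpa using this
  have h5 : 1 ≤ L * ∑ j ∈ J, ‖gradient (χ j) x‖ := by
    calc (1 : ℝ) = ‖w‖ := hw1.symm
      _ ≤ ∑ j ∈ J, ‖fderiv ℝ (χ j) x w • (a j - b)‖ := by
          conv_lhs => rw [h4]
          exact norm_sum_le _ _
      _ ≤ ∑ j ∈ J, L * ‖gradient (χ j) x‖ := by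
          refine Finset.sum_le_sum fun j hj => ?_
          rw [norm_smul, mul_comm, norm_gradient]
          refine mul_le_mul (ha j hj) ?_ (norm_nonneg _) hL
          simpa [hw1] using (fderiv ℝ (χ j) x).le_opNorm w
      _ = _ := by rw [Finset.mul_sum]
  have h6 : (∑ j ∈ J, ‖gradient (χ j) x‖) ^ 2 ≤ J.card * ∑ j ∈ J, ‖gradient (χ j) x‖ ^ 2 :=
    sq_sum_le_card_mul_sum_sq
  calc (1 : ℝ) ≤ (L * ∑ j ∈ J, ‖gradient (χ j) x‖) ^ 2 := one_le_pow₀ h5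
    _ = L ^ 2 * (∑ j ∈ J, ‖gradient (χ j) x‖) ^ 2 := by ring
    _ ≤ _ := by gcongr

theorem energyNorm_of_dim_zero {μ : Measure (Vec 0)} (U : SobPair 0 μ) : energyNorm U = 0 := by
  have h : ∀ x, U.snd x = 0 := fun x => Subsingleton.elim _ _
  simp [energyNorm, aForm, h]

namespace Setting

variable (S : Setting d)

theorem H_nonneg : 0 ≤ S.H := Real.iSup_nonneg fun _ => Metric.diam_nonneg

variable {S}

/-- Almost every point is interior to a block, so the reproduction of coordinates by the shape
functions holds in a neighbourhood and may be differentiated. At most 2^d nodes are involved, one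
for each corner of the cube. -/
theorem IsBilinear.one_le [NeZero d] {ρ : ℝ} (h : S.IsBilinear ρ) :
    ∀ᵐ x ∂S.vol, 1 ≤ (ρ * S.H) ^ 2 * (2 ^ d * S.κ x) := by
  obtain ⟨node, corner, hc⟩ := h
  have hdiff : ∀ᵐ x ∂S.vol, ∀ j, DifferentiableAt ℝ (S.χ j) x := ae_all_iff.2 fun j =>
    ae_differentiableAt_of_locallyLipschitzOn S.isOpen_dom (S.partition.locallyLipschitz j)
  have hvol : S.vol = Measure.sum fun i => S.vol.restrict (S.K i) := S.grid.restrict_eq_sum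
  rw [hvol, Measure.ae_sum_iff] at hdiff ⊢
  intro i
  have hi := hdiff i
  rw [restrict_restrict_eq_interior (S.grid.isClosed i) (S.grid.interior_subset i)
    (S.grid.frontier_null i)] at hi ⊢
  filter_upwards [hi, ae_restrict_mem isOpen_interior.measurableSet] with x hx hxi
  obtain ⟨-, hsub, hdist, hχ⟩ := hc i
  classical
  set J : Finset (Fin S.Nc) := Finset.univ.image (corner i) with hJ
  have hcard : (J.card : ℝ) ≤ 2 ^ d := by
    have : J.card ≤ 2 ^ d := by
      refine Finset.card_image_le.trans ?_
      simp
    exact_mod_cast this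
  -- A base corner is subtracted, which is legitimate since the χ_j sum to 1; only differences of
  -- corners then enter, and these are bounded by ρ H.
  set σ₀ : Fin d → Bool := fun _ => false
  have hL : 0 ≤ ρ * S.H := dist_nonneg.trans (hdist σ₀ σ₀)
  have hrep : ∀ y ∈ interior (S.K i),
      y - node (corner i σ₀) = ∑ j ∈ J, S.χ j y • (node j - node (corner i σ₀)) := by
    intro y hy
    have hyD := S.grid.interior_subset i hy
    obtain ⟨t, ht, rfl⟩ := hsub (interior_subset hy)
    have hval := hχ t ht ⟨interior_subset hy, hyD⟩
    set y := cellMap (fun σ => node (corner i σ)) t with hyt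
    have h1 : ∀ g : Fin S.Nc → Vec d, ∑ j, S.χ j y • g j = ∑ σ, shape σ t • g (corner i σ) := by
      intro g
      simp only [hval, Finset.sum_smul, ite_smul, zero_smul]
      rw [Finset.sum_comm]
      simp
    have h2 : ∀ j, j ∉ J → S.χ j y = 0 := fun j hj => by
      rw [hval]
      refine Finset.sum_eq_zero fun σ _ => if_neg fun h => hj ?_
      exact Finset.mem_image.2 ⟨σ, Finset.mem_univ _, h⟩
    have h3 : ∑ j ∈ J, S.χ j y • (node j - node (corner i σ₀)) =
        ∑ j, S.χ j y • (node j - node (corner i σ₀)) :=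
      Finset.sum_subset (Finset.subset_univ _) fun j _ hj => by rw [h2 j hj, zero_smul]
    rw [h3]
    simp only [smul_sub, Finset.sum_sub_distrib]
    rw [← Finset.sum_smul, S.partition.sum_eq_one y hyD, one_smul, h1]
    rfl
  have key := one_le_of_reproducing (J := J) (χ := S.χ) (a := node) (b := node (corner i σ₀))
    (L := ρ * S.H) (fun j _ => hx j) (fun j hj => by
      obtain ⟨σ, -, rfl⟩ := Finset.mem_image.1 hj
      rw [← dist_eq_norm]
      exact hdist σ σ₀) hL
    (eventually_of_mem (isOpen_interior.mem_nhds hxi) hrep)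
  refine key.trans ?_
  gcongr
  exact Finset.sum_le_sum_of_subset_of_nonneg (Finset.subset_univ _) fun _ _ _ => by positivity

/-- The constant uses |ρ| + 1 instead of |ρ| so that it is positive for every ρ. -/
theorem IsBilinear.rpow_κ_le [NeZero d] {ρ : ℝ} (h : S.IsBilinear ρ) :
    ∀ᵐ x ∂S.vol, S.κ x ^ (-(1 / 2) : ℝ) ≤ (|ρ| + 1) * √(2 ^ d) * S.H := by
  filter_upwards [h.one_le, S.κ_pos] with x hx hκ
  have hH := S.H_nonneg
  refine abs_le_of_sq_le_sq' ?_ (by positivity) |>.2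
  rw [← Real.rpow_natCast (S.κ x ^ _), ← Real.rpow_mul hκ.le]
  norm_num
  rw [Real.rpow_neg_one, mul_pow, mul_pow, Real.sq_sqrt (by positivity),
    inv_le_iff_one_le_mul₀ hκ]
  have h1 : ρ ^ 2 ≤ (|ρ| + 1) ^ 2 := by
    rw [← sq_abs ρ]
    gcongr
    linarith
  calc 1 ≤ (ρ * S.H) ^ 2 * (2 ^ d * S.κ x) := hx
    _ = ρ ^ 2 * (2 ^ d * S.H ^ 2 * S.κ x) := by ring
    _ ≤ (|ρ| + 1) ^ 2 * (2 ^ d * S.H ^ 2 * S.κ x) := by gcongr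
    _ = _ := by ring

/-- The error estimate for the multilinear partition of unity. -/
theorem IsBilinear.energyNorm_error_le {ρ : ℝ} (h : S.IsBilinear ρ) {f : Lp (Vec d) 2 S.vol}
    {u uglo : SobPair d S.vol} {p : Lp ℝ 2 S.vol} (hu : S.IsStokesSolution f u p)
    (hw : S.IsGlobalSolution f uglo) (hΛ : 0 < S.Λ) :
    energyNorm (u - uglo) ≤
      (|ρ| + 1) * √(2 ^ d) * S.H * S.Λ ^ (-(1 / 2) : ℝ) * ‖f‖ := by
  have hH := S.H_nonneg
  have hΛ' : 0 < S.Λ ^ (-(1 / 2) : ℝ) := Real.rpow_pos_of_pos hΛ _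
  -- The lower bound for κ needs a unit vector; in dimension 0 the energy norm is simply 0.
  rcases Nat.eq_zero_or_pos d with rfl | hd
  · rw [energyNorm_of_dim_zero]
    positivity
  have : NeZero d := ⟨hd.ne'⟩
  rw [← ENNReal.ofReal_le_ofReal_iff (by positivity)]
  refine (Setting.energyNorm_error_le hu hw hΛ).trans ?_
  have h1 : eLpNorm (fun x => (S.κ x) ^ (-(1 / 2) : ℝ) • f x) 2 S.vol ≤
      ENNReal.ofReal ((|ρ| + 1) * √(2 ^ d) * S.H) * eLpNorm f 2 S.vol := by
    refine eLpNorm_le_mul_eLpNorm_of_ae_le_mul ?_ 2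
    filter_upwards [h.rpow_κ_le, S.κ_pos] with x hx hκ
    rw [norm_smul, Real.norm_of_nonneg (Real.rpow_nonneg hκ.le _)]
    gcongr
  refine (mul_le_mul' le_rfl h1).trans_eq ?_
  rw [← Lp.enorm_def, ← ofReal_norm, ← ENNReal.ofReal_mul (by positivity),
    ← ENNReal.ofReal_mul hΛ'.le]
  congr 1
  ring

end Setting

end StokesCEM

/-! ### The three estimates -/

theorem mainTheorem3 :
    (∃ C : ℝ, 0 < C ∧ ∀ (d : ℕ) (S : StokesCEM.Setting d)
      (f : MeasureTheory.Lp (StokesCEM.Vec d) 2 S.vol)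
      (u : StokesCEM.SobPair d S.vol) (p : MeasureTheory.Lp ℝ 2 S.vol)
      (uglo : StokesCEM.SobPair d S.vol),
      S.IsStokesSolution f u p → S.IsGlobalSolution f uglo → 0 < S.Λ →
      ENNReal.ofReal (StokesCEM.energyNorm (u - uglo)) ≤
        ENNReal.ofReal (C * S.Λ ^ (-(1 / 2) : ℝ)) *
          MeasureTheory.eLpNorm (fun x => (S.κ x) ^ (-(1 / 2) : ℝ) • f x) 2 S.vol) ∧
    (∀ (d : ℕ) (ρ : ℝ), ∃ C : ℝ, 0 < C ∧ ∀ (S : StokesCEM.Setting d)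
      (f : MeasureTheory.Lp (StokesCEM.Vec d) 2 S.vol)
      (u : StokesCEM.SobPair d S.vol) (p : MeasureTheory.Lp ℝ 2 S.vol)
      (uglo : StokesCEM.SobPair d S.vol),
      S.IsBilinear ρ → S.IsStokesSolution f u p → S.IsGlobalSolution f uglo → 0 < S.Λ →
      StokesCEM.energyNorm (u - uglo) ≤ C * S.H * S.Λ ^ (-(1 / 2) : ℝ) * ‖f‖) ∧
    (∀ (d : ℕ) (ρ Λ₀ : ℝ), ∃ C : ℝ, 0 < C ∧ ∀ (S : StokesCEM.Setting d)
      (f : MeasureTheory.Lp (StokesCEM.Vec d) 2 S.vol)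
      (u : StokesCEM.SobPair d S.vol) (p : MeasureTheory.Lp ℝ 2 S.vol)
      (uglo : StokesCEM.SobPair d S.vol),
      S.IsBilinear ρ → S.IsStokesSolution f u p → S.IsGlobalSolution f uglo →
      0 < S.Λ → S.Λ ≤ Λ₀ →
      StokesCEM.energyNorm (u - uglo) ≤ C * S.H * S.Λ⁻¹ * ‖f‖) := by
  refine ⟨⟨1, one_pos, fun d S f u p uglo hu hw hΛ => ?_⟩,
    fun d ρ => ⟨(|ρ| + 1) * √(2 ^ d), by positivity, fun S f u p uglo h hu hw hΛ => ?_⟩,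
    fun d ρ Λ₀ => ⟨(|ρ| + 1) * √(2 ^ d) * (√Λ₀ + 1), by positivity,
      fun S f u p uglo h hu hw hΛ hΛ₀ => ?_⟩⟩
  · rw [one_mul]
    exact StokesCEM.Setting.energyNorm_error_le hu hw hΛ
  · exact h.energyNorm_error_le hu hw hΛ
  · have hH := S.H_nonneg
    -- Since Λ^(-1/2) = √Λ · Λ⁻¹, the bound Λ ≤ Λ₀ trades one rate for the other. The added 1 keeps
    -- the constant positive when Λ₀ ≤ 0.
    have h1 : S.Λ ^ (-(1 / 2) : ℝ) ≤ (√Λ₀ + 1) * S.Λ⁻¹ := by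
      have h2 : S.Λ ^ (-(1 / 2) : ℝ) = √S.Λ * S.Λ⁻¹ := by
        rw [Real.sqrt_eq_rpow, ← Real.rpow_neg_one, ← Real.rpow_add hΛ]
        norm_num
      rw [h2]
      gcongr
      linarith [Real.sqrt_le_sqrt hΛ₀]
    calc StokesCEM.energyNorm (u - uglo)
        ≤ (|ρ| + 1) * √(2 ^ d) * S.H * S.Λ ^ (-(1 / 2) : ℝ) * ‖f‖ :=
          h.energyNorm_error_le hu hw hΛ
      _ ≤ (|ρ| + 1) * √(2 ^ d) * S.H * ((√Λ₀ + 1) * S.Λ⁻¹) * ‖f‖ := by gcongr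
      _ = _ := by ring
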